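/- **Conventions.** $\mathrm{vol}$ is Lebesgue measure on $\mathbb R$, $\mathsf{TV}(P,Q)=\sup_B|P(B)-Q(B)|$ over Borel sets $B$, and $\mathrm{OPT}(P,\beta)=\inf\{\mathrm{vol}(C): C\subseteq\mathbb R \text{ Borel},\ P(C)\ge\beta\}$. Let $\mathcal C_k$ be the class of unions of $k$ intervals (possibly empty or degenerate). A $k$-component Gaussian mixture is $\sum_{j=1}^k w_jN(\mu_j,\sigma_j^2)$ with $w_j\ge0$, $\sum_j w_j=1$, $\sigma_j>0$. **The dynamic program.** Given data with order statistics $Y_{(1)}\le\dots\le Y_{(n)}$, a number $k$ of intervals, a level $\beta$ and a slack $\gamma$, put $c^\ast=\lceil l\gamma n\rceil$ with $l=\lceil\beta/\gamma\rceil$. The table $D(i,j,c)$ is the minimal total length of $i$ intervals with endpoints at data points that collectively cover $c$ of the points $Y_{(1)},\dots,Y_{(j)}$, the right endpoint of the rightmost one being $Y_{(j)}$; it is computed by $$D(1,j,c)=\min_{j'\le j,\ j-j'+1\ge c}\bigl(Y_{(j)}-Y_{(j')}\bigr),$$ $$D(i,j,c)=\min_{j''<j'\le j}\bigl\{Y_{(j)}-Y_{(j')}+D(i-1,j'',\max(0,\,c-(j-j'+1)))\bigr\}\quad(i>1),$$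 a minimum over the empty set being $\infty$. The output is the union of the $k$ intervals found by backtracking from an entry $D(k,j,c^\ast)$ that is minimal over $1\le j\le n$ (ties broken in any way). **Theorem C.1.** There is a universal constant $K>0$ such that the following holds. Let $n,k\ge1$, let $Y_1,\dots,Y_n,Y_{n+1}$ be i.i.d. from a probability distribution $P$ on $\mathbb R$, and suppose that $\mathsf{TV}(P_k,P)\le\epsilon_k$ for some $k$-component Gaussian mixture $P_k$. Let $\alpha,\delta,\gamma\in(0,1)$ satisfy $$\delta\ \ge\ K\sqrt{\frac{k+\log n}{n}}\qquad\text{and}\qquad \gamma+2\delta+2\epsilon_k<\alpha .$$ Then the dynamic program with $k$ intervals, coverage level $1-\alpha+\delta$ and slack $\gamma$, run on $Y_1,\dots,Y_n$, always has an output, and with probability at least $1-\delta$ every such output $\widehat C_{\rm DP}$ belongs to $\mathcal C_k$ and satisfies 1. $\mathbb P\bigl(Y_{n+1}\in\widehat C_{\rm DP}\mid Y_1,\dots,Y_n\bigr)\ge1-\alpha$; 2. $\mathrm{vol}(\widehat C_{\rm DP})\le\mathrm{OPT}(P,\,1-\alpha+\gamma+2\delta+2\epsilon_k)$. -/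

import Mathlib

open MeasureTheory ProbabilityTheory
open scoped ENNReal NNReal

/-- `C` is a union of `k` intervals of the real line.  An interval is an order-connected set: open,
closed or half-open, bounded or not, possibly empty or a single point. -/
def IsUnionOfIntervals (k : ℕ) (C : Set ℝ) : Prop :=
  ∃ I : Fin k → Set ℝ, (∀ i, (I i).OrdConnected) ∧ C = ⋃ i, I i

/-- The optimal volume `OPT(P, β) = inf {vol(C) : P(C) ≥ β}`, the infimum being over all (Borel)
measurable sets. -/
noncomputable def optVolume (P : Measure ℝ) (β : ℝ) : ℝ≥0∞ :=
  ⨅ (C : Set ℝ) (_ : MeasurableSet C) (_ : ENNReal.ofReal β ≤ P C), volume C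

/-- The total variation distance `TV(P, Q) = sup_B |P(B) - Q(B)|`, over measurable sets `B`. -/
noncomputable def tvDistance (P Q : Measure ℝ) : ℝ :=
  ⨆ B : {B : Set ℝ // MeasurableSet B}, |P.real B.1 - Q.real B.1|

/-- `Q` is a mixture `∑ j, w j • N(m j, v j)` of `k` non-degenerate Gaussians (`v j` is the
variance). -/
def IsGaussianMixture (k : ℕ) (Q : Measure ℝ) : Prop :=
  ∃ (w : Fin k → ℝ≥0) (m : Fin k → ℝ) (v : Fin k → ℝ≥0),
    ∑ j, w j = 1 ∧ (∀ j, 0 < v j) ∧ Q = ∑ j, w j • gaussianReal (m j) (v j)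

/-- The sample `y` in non-decreasing order. -/
noncomputable def orderStat {n : ℕ} (y : Fin n → ℝ) : Fin n → ℝ := y ∘ Tuple.sort y

/-- The dynamic programming table for the sorted sample `z`.  The entry `dpTable z i j c` is the
minimal total length of `i` intervals with endpoints in the sample that collectively cover `c` of
the points `z 0, …, z j`, the right endpoint of the rightmost interval being `z j`; it is `∞` if
there is no feasible solution.  The rightmost interval is `[z j', z j]` and accounts for the
`j - j' + 1` points with indices in `{j', …, j}`; the remaining `i - 1` intervals, the rightmost of
which ends at `z j''` with `j'' < j'`, have to cover the remaining `c - (j - j' + 1)` points (none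
if this number is negative: the subtraction is truncated). -/
noncomputable def dpTable {n : ℕ} (z : Fin n → ℝ) : ℕ → Fin n → ℕ → ℝ≥0∞
  | 0, _, _ => ⊤
  | 1, j, c =>
      ⨅ (j' : Fin n) (_ : j' ≤ j) (_ : c ≤ (j : ℕ) - (j' : ℕ) + 1), ENNReal.ofReal (z j - z j')
  | i + 2, j, c =>
      ⨅ (j' : Fin n) (_ : j' ≤ j) (j'' : Fin n) (_ : j'' < j'),
        ENNReal.ofReal (z j - z j') + dpTable z (i + 1) j'' (c - ((j : ℕ) - (j' : ℕ) + 1))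

/-- Backtracking in the table: `DPBacktrack z i j c C` says that the set `C` is obtained from the
entry `(i, j, c)` by following choices that attain the minima, adding one interval at a time. -/
inductive DPBacktrack {n : ℕ} (z : Fin n → ℝ) : ℕ → Fin n → ℕ → Set ℝ → Prop
  | base {j j' : Fin n} {c : ℕ} (hj : j' ≤ j) (hc : c ≤ (j : ℕ) - (j' : ℕ) + 1)
      (hmin : dpTable z 1 j c = ENNReal.ofReal (z j - z j')) :
      DPBacktrack z 1 j c (Set.Icc (z j') (z j))
  | step {i : ℕ} {j j' j'' : Fin n} {c : ℕ} {C : Set ℝ} (hj : j' ≤ j) (hj' : j'' < j')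
      (hmin : dpTable z (i + 2) j c = ENNReal.ofReal (z j - z j') +
        dpTable z (i + 1) j'' (c - ((j : ℕ) - (j' : ℕ) + 1)))
      (hC : DPBacktrack z (i + 1) j'' (c - ((j : ℕ) - (j' : ℕ) + 1)) C) :
      DPBacktrack z (i + 2) j c (C ∪ Set.Icc (z j') (z j))

/-- The number `⌈l γ n⌉` of points to be covered, where `l = ⌈β / γ⌉` is the level `β` in units of
the slack `γ`, rounded up. -/
noncomputable def dpTarget (n : ℕ) (β γ : ℝ) : ℕ := ⌈(⌈β / γ⌉₊ : ℝ) * γ * (n : ℝ)⌉₊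

/-- `C` is an output of the dynamic programming algorithm run on the data `y` with `k` intervals,
coverage level `β` and slack `γ`: a solution of minimal volume among all the entries
`(k, j, dpTarget n β γ)`, found by backtracking.  Every way of breaking ties is allowed. -/
def IsDPOutput {n : ℕ} (y : Fin n → ℝ) (k : ℕ) (β γ : ℝ) (C : Set ℝ) : Prop :=
  ∃ j : Fin n,
    (∀ j₁ : Fin n, dpTable (orderStat y) k j (dpTarget n β γ) ≤
      dpTable (orderStat y) k j₁ (dpTarget n β γ)) ∧
    DPBacktrack (orderStat y) k j (dpTarget n β γ) C

/-! ### The dynamic program -/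

/-! Let `A` be a set of least volume among those of mixture mass at least `1 - α + γ + 2δ + ε`.
Passing between `P` and the mixture costs `ε` each way: every competitor in the optimum has at least
this mixture mass, so `A` is no larger than the optimum, while `P(A) ≥ 1 - α + γ + 2δ`. If `A` is a
union of `k` intervals and the empirical measure is close to `P`, then `A` holds enough points to
compete in the program, so the output is no larger than `A`. The output itself holds at least `n (1
- α + δ)` points, hence has mass at least `1 - α`. Three facts make this work.

Optimality of the program: an output holds its target number of points, and its volume is at most
that of any union of `k` intervals holding that many points and at least `k`
(`IsDPOutput.dpTarget_le_card`, `IsDPOutput.volume_le`).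

Shape of `A`: by Neyman-Pearson, `A` may be taken to be a superlevel set of the mixture density `f`,
so it suffices that `f` crosses each level `t > 0` at most `2k` times. Induct on the number of
components. Subtracting the least variance `v₀` from all of them turns the narrowest components into
point masses, and `t - f` comes back by convolution with `N(0, v₀)`. Up to a positive factor this
convolution is a Laplace transform, which by Rolle has no more zeros than its source has sign
changes (`card_zeros_laplace_le`); an atom counts as two.

Deviations of order `√(k/n)`: a union bound over all interval patterns would cost a further
logarithm. After symmetrization with a ghost sample, the sum of random signs over any union of `k`
intervals is instead dominated by `c k + n / (2c)` plus a single martingale that does not depend on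
the union (`sum_indicator_le_clampWalk`). Its exponential moments give the tail. The fixed set `A`
only needs Hoeffding's inequality. -/

theorem exists_eq_iInf_of_lt_top {ι : Type*} [Finite ι] {p : ι → Prop} {f : ι → ℝ≥0∞}
    (h : ⨅ (i) (_ : p i), f i < ⊤) : ∃ i, p i ∧ ⨅ (i) (_ : p i), f i = f i := by
  rcases isEmpty_or_nonempty ι with hι | hι
  · simp at h
  obtain ⟨i, hi⟩ := exists_eq_ciInf_of_finite (f := fun i => ⨅ (_ : p i), f i)
  have hp : p i := by
    by_contra hp
    rw [← hi] at h
    simp [hp] at h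
  refine ⟨i, hp, ?_⟩
  rw [← hi]
  simp [hp]

theorem dpTable_one {n : ℕ} (z : Fin n → ℝ) (j : Fin n) (c : ℕ) :
    dpTable z 1 j c = ⨅ (j' : Fin n) (_ : j' ≤ j ∧ c ≤ (j : ℕ) - (j' : ℕ) + 1),
      ENNReal.ofReal (z j - z j') := by
  simp only [dpTable, iInf_and]

/-- One infimum over admissible pairs, so that `exists_eq_iInf_of_lt_top` yields a minimizing
choice. -/
theorem dpTable_add_two {n : ℕ} (z : Fin n → ℝ) (i : ℕ) (j : Fin n) (c : ℕ) :
    dpTable z (i + 2) j c = ⨅ (q : Fin n × Fin n) (_ : q.1 ≤ j ∧ q.2 < q.1),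
      (ENNReal.ofReal (z j - z q.1) +
        dpTable z (i + 1) q.2 (c - ((j : ℕ) - (q.1 : ℕ) + 1))) := by
  simp only [dpTable, iInf_and, iInf_prod]
  refine iInf_congr fun j' => ?_
  rw [iInf_comm]

theorem DPBacktrack.exists_of_lt_top {n : ℕ} {z : Fin n → ℝ} (i : ℕ) :
    ∀ {j : Fin n} {c : ℕ}, dpTable z (i + 1) j c < ⊤ → ∃ C, DPBacktrack z (i + 1) j c C := by
  induction i with
  | zero =>
    intro j c h
    have h' := h
    simp only [zero_add] at h' ⊢
    rw [dpTable_one] at h'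
    obtain ⟨j', hj', he⟩ := exists_eq_iInf_of_lt_top h'
    exact ⟨_, .base hj'.1 hj'.2 (by rw [dpTable_one, he])⟩
  | succ i ih =>
    intro j c h
    have h' := h
    rw [dpTable_add_two] at h'
    obtain ⟨q, hq, he⟩ := exists_eq_iInf_of_lt_top h'
    rw [he] at h'
    obtain ⟨C, hC⟩ := ih (lt_of_le_of_lt le_add_self h')
    exact ⟨_, .step hq.1 hq.2 (by rw [dpTable_add_two, he]) hC⟩

theorem DPBacktrack.exists_eq_iUnion_Icc {n : ℕ} {z : Fin n → ℝ} {i : ℕ} {j : Fin n} {c : ℕ}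
    {C : Set ℝ} (h : DPBacktrack z i j c C) :
    ∃ a b : Fin i → Fin n, C = ⋃ l, Set.Icc (z (a l)) (z (b l)) := by
  induction h with
  | @base j j' c hj hc hmin => exact ⟨fun _ => j', fun _ => j, (Set.iUnion_const _).symm⟩
  | @step i j j' j'' c C hj hj' hmin hC ih =>
    obtain ⟨a, b, rfl⟩ := ih
    refine ⟨Fin.cons j' a, Fin.cons j b, ?_⟩
    ext x
    simp only [Set.mem_union, Set.mem_iUnion, Fin.exists_fin_succ, Fin.cons_zero, Fin.cons_succ]
    exact or_comm

/-- Subadditivity is enough; the intervals may share endpoints when the data have ties. -/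
theorem DPBacktrack.volume_le {n : ℕ} {z : Fin n → ℝ} {i : ℕ} {j : Fin n} {c : ℕ}
    {C : Set ℝ} (h : DPBacktrack z i j c C) : volume C ≤ dpTable z i j c := by
  induction h with
  | @base j j' c hj hc hmin => rw [hmin, Real.volume_Icc]
  | @step i j j' j'' c C hj hj' hmin hC ih =>
    rw [hmin, add_comm]
    refine (measure_union_le _ _).trans ?_
    rw [Real.volume_Icc]
    gcongr

/-- Points are counted by index, so ties are harmless. Quantifying over `T` drives the induction:
the block of indices from `j'` to `j` is removed from `T`, and the earlier intervals are charged to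
the rest, where only indices up to `j'' < j'` matter. -/
theorem DPBacktrack.le_card {n : ℕ} {z : Fin n → ℝ} (hz : Monotone z) {i : ℕ} {j : Fin n} {c : ℕ}
    {C : Set ℝ} (h : DPBacktrack z i j c C) :
    ∀ T : Finset (Fin n), (∀ m, m ≤ j → z m ∈ C → m ∈ T) → c ≤ T.card := by
  induction h with
  | @base j j' c hj hc hmin =>
    intro T hT
    have : Finset.Icc j' j ⊆ T := fun m hm => by
      rw [Finset.mem_Icc] at hm
      exact hT m hm.2 ⟨hz hm.1, hz hm.2⟩
    have h1 := Finset.card_le_card this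
    rw [Fin.card_Icc] at h1
    have : (j' : ℕ) ≤ j := hj
    omega
  | @step i j j' j'' c C hj hj' hmin hC ih =>
    intro T hT
    have h1 : Finset.Icc j' j ⊆ T := fun m hm => by
      rw [Finset.mem_Icc] at hm
      exact hT m hm.2 (Or.inr ⟨hz hm.1, hz hm.2⟩)
    have h2 := ih (T \ Finset.Icc j' j) fun m hm hmC => by
      rw [Finset.mem_sdiff, Finset.mem_Icc]
      exact ⟨hT m (hm.trans (hj'.le.trans hj)) (Or.inl hmC),
        fun h => absurd (hj'.trans_le h.1) (not_lt.2 hm)⟩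
    rw [Finset.card_sdiff_of_subset h1, Fin.card_Icc] at h2
    have h3 := Finset.card_le_card h1
    rw [Fin.card_Icc] at h3
    have : (j' : ℕ) ≤ j := hj
    omega

theorem dpTable_one_le {n : ℕ} {z : Fin n → ℝ} {j j' : Fin n} {c : ℕ} (hj : j' ≤ j)
    (hc : c ≤ (j : ℕ) - (j' : ℕ) + 1) : dpTable z 1 j c ≤ ENNReal.ofReal (z j - z j') := by
  rw [dpTable_one]
  exact iInf₂_le j' ⟨hj, hc⟩

theorem dpTable_add_two_le {n : ℕ} {z : Fin n → ℝ} {i : ℕ} {j j' j'' : Fin n} {c : ℕ}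
    (hj : j' ≤ j) (hj' : j'' < j') : dpTable z (i + 2) j c ≤ ENNReal.ofReal (z j - z j') +
      dpTable z (i + 1) j'' (c - ((j : ℕ) - (j' : ℕ) + 1)) := by
  rw [dpTable_add_two]
  exact iInf₂_le (j', j'') ⟨hj, hj'⟩

/-- Single points are intervals of length zero. They use up surplus intervals, since the table
insists on exactly `i + 1` nonempty index blocks. -/
theorem exists_dpTable_eq_zero {n : ℕ} (z : Fin n → ℝ) (i : ℕ) :
    ∀ (T : Finset (Fin n)) (c : ℕ), T.card = i + 1 → c ≤ i + 1 →
      ∃ j ∈ T, dpTable z (i + 1) j c = 0 := by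
  induction i with
  | zero =>
    intro T c hT hc
    obtain ⟨j, hj⟩ := Finset.card_pos.1 (by omega : 0 < T.card)
    refine ⟨j, hj, le_antisymm ((dpTable_one_le le_rfl (by omega)).trans (by simp)) zero_le⟩
  | succ i ih =>
    intro T c hT hc
    have hne : T.Nonempty := Finset.card_pos.1 (by omega)
    have hm := T.max'_mem hne
    obtain ⟨j'', hj'', h0⟩ := ih (T.erase (T.max' hne)) (c - 1)
      (by rw [Finset.card_erase_of_mem hm]; omega) (by omega)
    have hlt : j'' < T.max' hne := T.lt_max'_of_mem_erase_max' hne hj''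
    refine ⟨_, hm, le_antisymm ((dpTable_add_two_le le_rfl hlt).trans ?_) zero_le⟩
    simp [h0]

theorem Finset.exists_initial_subset {α : Type*} [LinearOrder α] (A : Finset α) :
    ∀ m ≤ A.card, ∃ T ⊆ A, T.card = m ∧ ∀ x ∈ A \ T, ∀ t ∈ T, t < x := by
  induction A using Finset.induction_on_max with
  | empty => exact fun m hm => ⟨∅, by simp, by simpa [eq_comm] using hm, by simp⟩
  | insert a s ha ih =>
    intro m hm
    have has : a ∉ s := fun h => lt_irrefl _ (ha a h)
    rw [Finset.card_insert_of_notMem has] at hm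
    rcases hm.lt_or_eq with h | h
    · obtain ⟨T, hTs, hc, hT⟩ := ih m (by omega)
      refine ⟨T, hTs.trans (Finset.subset_insert _ _), hc, fun x hx t ht => ?_⟩
      rw [Finset.mem_sdiff, Finset.mem_insert] at hx
      rcases hx.1 with rfl | hxs
      · exact ha t (hTs ht)
      · exact hT x (Finset.mem_sdiff.2 ⟨hxs, hx.2⟩) t ht
    · exact ⟨_, Finset.Subset.refl _, by rw [Finset.card_insert_of_notMem has, h], by simp⟩

/-- The table is at most the volume of any union of intervals that holds enough points. -/
theorem exists_dpTable_le_volume {n : ℕ} {z : Fin n → ℝ} (hz : Monotone z) (i : ℕ) :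
    ∀ (I : Fin (i + 1) → Set ℝ) (A : Finset (Fin n)) (c : ℕ), (∀ l, (I l).OrdConnected) →
      (∀ m, m ∈ A ↔ z m ∈ ⋃ l, I l) → i + 1 ≤ A.card → c ≤ A.card →
      ∃ j ∈ A, dpTable z (i + 1) j c ≤ volume (⋃ l, I l) := by
  induction i with
  | zero =>
    intro I A c hI hA hi hc
    have hne : A.Nonempty := Finset.card_pos.1 (by omega)
    have hU : ⋃ l, I l = I 0 := by ext; simp [Fin.exists_fin_succ]
    rw [hU] at hA ⊢
    set j := A.max' hne
    set j' := A.min' hne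
    have hj : j ∈ A := A.max'_mem hne
    have hj' : j' ∈ A := A.min'_mem hne
    have hle : j' ≤ j := A.min'_le _ hj
    refine ⟨j, hj, (dpTable_one_le hle ?_).trans ?_⟩
    · have : A ⊆ Finset.Icc j' j := fun m hm =>
        Finset.mem_Icc.2 ⟨A.min'_le _ hm, A.le_max' _ hm⟩
      have h1 := Finset.card_le_card this
      rw [Fin.card_Icc] at h1
      have : (j' : ℕ) ≤ j := hle
      omega
    · rw [← Real.volume_Icc]
      exact measure_mono ((hI 0).out ((hA _).1 hj') ((hA _).1 hj))
  | succ i ih =>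
    intro I A c hI hA hi hc
    have hne : A.Nonempty := Finset.card_pos.1 (by omega)
    -- Peel off the interval `I l` containing the last covered point; `j'` is the first sample point
    -- in it.
    set j := A.max' hne with hjdef
    have hj : j ∈ A := A.max'_mem hne
    obtain ⟨l, hl⟩ := Set.mem_iUnion.1 ((hA _).1 hj)
    classical
    set B := A.filter fun m => z m ∈ I l with hB
    have hBne : B.Nonempty := ⟨j, by simp [hB, hj, hl]⟩
    set j' := B.min' hBne with hj'def
    have hj'B : j' ∈ B := B.min'_mem hBne
    have hj'A : j' ∈ A := (Finset.mem_filter.1 hj'B).1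
    have hj'l : z j' ∈ I l := (Finset.mem_filter.1 hj'B).2
    have hle : j' ≤ j := A.le_max' _ hj'A
    -- The other intervals are cut at `z j'`, which makes them disjoint from `[z j', z j]`, so that
    -- volumes add.
    set I' : Fin (i + 1) → Set ℝ := fun m => I (l.succAbove m) ∩ Set.Iio (z j') with hI'
    set A' : Finset (Fin n) := Finset.univ.filter fun m => z m ∈ ⋃ q, I' q with hA'
    have hlt : ∀ m ∈ A', m < j' := by
      intro m hm
      obtain ⟨q, hq⟩ := Set.mem_iUnion.1 (Finset.mem_filter.1 hm).2
      exact hz.reflect_lt hq.2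
    have hsplit : ∀ m ∈ A, m < j' → m ∈ A' := by
      intro m hm hmj
      obtain ⟨q, hq⟩ := Set.mem_iUnion.1 ((hA _).1 hm)
      have hml : z m ∉ I l := fun h =>
        absurd (B.min'_le m (Finset.mem_filter.2 ⟨hm, h⟩)) (not_le.2 hmj)
      have hql : q ≠ l := by rintro rfl; exact hml hq
      obtain ⟨q, rfl⟩ := Fin.exists_succAbove_eq hql
      refine Finset.mem_filter.2 ⟨Finset.mem_univ _, Set.mem_iUnion.2 ⟨q, hq, ?_⟩⟩
      refine lt_of_le_of_ne (hz hmj.le) fun h => hml ?_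
      rw [h]; exact hj'l
    have hcard : ∀ q : Fin n, q ≤ j → (Finset.Icc q j).card = (j : ℕ) - q + 1 := fun q hq => by
      rw [Fin.card_Icc]
      have : (q : ℕ) ≤ j := hq
      omega
    have hIcc : Set.Icc (z j') (z j) ⊆ I l := (hI l).out hj'l hl
    by_cases hc' : i + 1 ≤ A'.card
    · have hAsub : A ⊆ A' ∪ Finset.Icc j' j := fun m hm => by
        rw [Finset.mem_union, Finset.mem_Icc]
        rcases lt_or_ge m j' with h | h
        · exact Or.inl (hsplit m hm h)
        · exact Or.inr ⟨h, A.le_max' _ hm⟩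
      have h1 := (Finset.card_le_card hAsub).trans (Finset.card_union_le _ _)
      rw [hcard _ hle] at h1
      obtain ⟨j'', hj'', hle''⟩ := ih I' A' (c - ((j : ℕ) - j' + 1))
        (fun q => (hI _).inter Set.ordConnected_Iio) (by simp [hA']) hc' (by omega)
      refine ⟨j, hj, (dpTable_add_two_le hle (hlt _ hj'')).trans ?_⟩
      have hdis : Disjoint (Set.Icc (z j') (z j)) (⋃ q, I' q) := by
        rw [Set.disjoint_left]
        intro x hx hx'
        obtain ⟨q, hq⟩ := Set.mem_iUnion.1 hx'
        exact absurd hx.1 (not_le.2 hq.2)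
      calc _ ≤ volume (Set.Icc (z j') (z j)) + volume (⋃ q, I' q) := by
            rw [Real.volume_Icc]; gcongr
        _ = volume (Set.Icc (z j') (z j) ∪ ⋃ q, I' q) :=
            (measure_union' hdis measurableSet_Icc).symm
        _ ≤ _ := by
            refine measure_mono (Set.union_subset ?_ ?_)
            · exact hIcc.trans (Set.subset_iUnion I l)
            · exact Set.iUnion_subset fun q =>
                Set.inter_subset_left.trans (Set.subset_iUnion I _)
    -- Too few points remain on the left for the induction. Take the `i + 1` lowest covered points
    -- as singletons and one interval from the next point `q` to `j`. The singletons cannot all lie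
    -- below `j'`, so `q ≥ j'` and this interval stays inside `I l`.
    · push Not at hc'
      obtain ⟨T, hTA, hTc, hT⟩ := A.exists_initial_subset (i + 1) (by omega)
      have hne' : (A \ T).Nonempty := by
        rw [← Finset.card_pos, Finset.card_sdiff_of_subset hTA]; omega
      set q := (A \ T).min' hne'
      have hq : q ∈ A \ T := (A \ T).min'_mem hne'
      have hqA := (Finset.mem_sdiff.1 hq).1
      have hqj : q ≤ j := A.le_max' _ hqA
      have hj'q : j' ≤ q := by
        by_contra hlt'
        push Not at hlt'
        have : T ⊆ A' := fun m hm => hsplit m (hTA hm) ((hT q hq m hm).trans hlt')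
        have := Finset.card_le_card this
        omega
      have hAsub : A ⊆ T ∪ Finset.Icc q j := fun m hm => by
        rw [Finset.mem_union, Finset.mem_Icc]
        by_cases h : m ∈ T
        · exact Or.inl h
        · exact Or.inr ⟨(A \ T).min'_le _ (Finset.mem_sdiff.2 ⟨hm, h⟩), A.le_max' _ hm⟩
      have h1 := (Finset.card_le_card hAsub).trans (Finset.card_union_le _ _)
      rw [hcard _ hqj] at h1
      obtain ⟨j'', hj'', h0⟩ := exists_dpTable_eq_zero z i T (c - ((j : ℕ) - q + 1)) hTc (by omega)
      refine ⟨j, hj, (dpTable_add_two_le hqj (hT q hq _ hj'')).trans ?_⟩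
      rw [h0, add_zero]
      calc ENNReal.ofReal (z j - z q) ≤ ENNReal.ofReal (z j - z j') :=
            ENNReal.ofReal_le_ofReal (by linarith [hz hj'q])
        _ = volume (Set.Icc (z j') (z j)) := Real.volume_Icc.symm
        _ ≤ _ := measure_mono (hIcc.trans (Set.subset_iUnion I l))

/-! ### Outputs on the unsorted sample -/

theorem orderStat_monotone {n : ℕ} (y : Fin n → ℝ) : Monotone (orderStat y) :=
  Tuple.monotone_sort y

open Classical in
/-- The number of sample points in `C`. -/
noncomputable def sampleCount {n : ℕ} (y : Fin n → ℝ) (C : Set ℝ) : ℕ :=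
  (Finset.univ.filter fun i => y i ∈ C).card

theorem sampleCount_orderStat {n : ℕ} (y : Fin n → ℝ) (C : Set ℝ) :
    sampleCount (orderStat y) C = sampleCount y C := by
  classical
  unfold sampleCount
  exact Finset.card_equiv (Tuple.sort y) fun i => by
    rw [Finset.mem_filter, Finset.mem_filter]; simp [orderStat]

theorem IsDPOutput.exists_eq_iUnion_Icc {n k : ℕ} {y : Fin n → ℝ} {β γ : ℝ} {C : Set ℝ}
    (h : IsDPOutput y k β γ C) : ∃ a b : Fin k → Fin n, C = ⋃ l, Set.Icc (y (a l)) (y (b l)) := by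
  obtain ⟨j, -, h⟩ := h
  obtain ⟨a, b, rfl⟩ := h.exists_eq_iUnion_Icc
  exact ⟨_, _, rfl⟩

theorem IsDPOutput.dpTarget_le_card {n k : ℕ} {y : Fin n → ℝ} {β γ : ℝ} {C : Set ℝ}
    (h : IsDPOutput y k β γ C) :
    dpTarget n β γ ≤ sampleCount y C := by
  obtain ⟨j, -, h⟩ := h
  rw [← sampleCount_orderStat]
  exact h.le_card (orderStat_monotone y) _ fun m _ hm => by simpa using hm

theorem IsDPOutput.volume_le {n k : ℕ} {y : Fin n → ℝ} {β γ : ℝ} {C C' : Set ℝ}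
    (h : IsDPOutput y k β γ C) (hk : 1 ≤ k) (hC' : IsUnionOfIntervals k C')
    (hkc : k ≤ sampleCount y C')
    (hc : dpTarget n β γ ≤ sampleCount y C') :
    volume C ≤ volume C' := by
  obtain ⟨j, hmin, h⟩ := h
  obtain ⟨I, hI, rfl⟩ := hC'
  obtain ⟨k, rfl⟩ : ∃ i, k = i + 1 := ⟨k - 1, by omega⟩
  rw [← sampleCount_orderStat] at hkc hc
  obtain ⟨j₁, -, hj₁⟩ := exists_dpTable_le_volume (orderStat_monotone y) k I _ _ hI
    (by simp) hkc hc
  exact (h.volume_le.trans (hmin j₁)).trans hj₁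

theorem exists_isDPOutput {n k : ℕ} (y : Fin n → ℝ) {β γ : ℝ} (hk : 1 ≤ k) (hkn : k ≤ n)
    (hc : dpTarget n β γ ≤ n) : ∃ C, IsDPOutput y k β γ C := by
  obtain ⟨k, rfl⟩ : ∃ i, k = i + 1 := ⟨k - 1, by omega⟩
  have hn : NeZero n := ⟨by omega⟩
  set z := orderStat y
  obtain ⟨j, hj⟩ := exists_eq_ciInf_of_finite (f := fun j => dpTable z (k + 1) j (dpTarget n β γ))
  have hmin : ∀ j₁, dpTable z (k + 1) j (dpTarget n β γ) ≤
      dpTable z (k + 1) j₁ (dpTarget n β γ) := fun j₁ => by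
    rw [hj]; exact iInf_le _ j₁
  -- Copies of the full sample range witness that some entry of the table is finite.
  set I : Fin (k + 1) → Set ℝ := fun _ => Set.Icc (z ⊥) (z ⊤)
  have hI : ⋃ l, I l = Set.Icc (z ⊥) (z ⊤) := Set.iUnion_const _
  obtain ⟨j₁, -, hj₁⟩ := exists_dpTable_le_volume (orderStat_monotone y) k I Finset.univ
    (dpTarget n β γ) (fun _ => Set.ordConnected_Icc)
    (fun m => by
      simp only [Finset.mem_univ, true_iff, hI]
      exact ⟨orderStat_monotone y bot_le, orderStat_monotone y le_top⟩)
    (by simpa using hkn) (by simpa using hc)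
  rw [hI, Real.volume_Icc] at hj₁
  obtain ⟨C, hC⟩ := DPBacktrack.exists_of_lt_top k
    (((hmin j₁).trans hj₁).trans_lt ENNReal.ofReal_lt_top)
  exact ⟨C, j, hmin, hC⟩

/-! ### Zeros of Laplace transforms -/

/-- Rolle's theorem for finite sets of zeros. -/
theorem exists_finset_deriv_zero {f f' : ℝ → ℝ} (hf : ∀ x, HasDerivAt f (f' x) x) {m : ℕ}
    (Z : Finset ℝ) (hZ : ∀ x ∈ Z, f x = 0) (hc : Z.card = m + 1) :
    ∃ Z' : Finset ℝ, (∀ x ∈ Z', f' x = 0) ∧ Z'.card = m := by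
  set e := Z.orderEmbOfFin hc
  have he : ∀ i, f (e i) = 0 := fun i => hZ _ (Z.orderEmbOfFin_mem hc i)
  have hR : ∀ i : Fin m, ∃ x ∈ Set.Ioo (e i.castSucc) (e i.succ), f' x = 0 := fun i =>
    exists_hasDerivAt_eq_zero (e.strictMono Fin.castSucc_lt_succ)
      (fun x _ => (hf x).continuousAt.continuousWithinAt) ((he _).trans (he _).symm)
      fun x _ => hf x
  choose ξ hξ h0 using hR
  have hmono : StrictMono ξ := by
    intro i j hij
    calc ξ i < e i.succ := (hξ i).2
      _ ≤ e j.castSucc := e.monotone (Fin.succ_le_castSucc_iff.2 hij)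
      _ < ξ j := (hξ j).1
  refine ⟨Finset.univ.image ξ, ?_, ?_⟩
  · simpa using h0
  · rw [Finset.card_image_of_injective _ hmono.injective]; simp

/-- `|y| ≤ exp y + exp (-y)`, so a linear factor is absorbed by moving `x` to `x ± 1`. -/
theorem integrable_sub_mul_exp {g : ℝ → ℝ} (hg : ∀ x, Integrable fun y => g y * Real.exp (x * y))
    (a : ℝ) (x : ℝ) : Integrable fun y => g y * (y - a) * Real.exp (x * y) := by
  have hm : ∀ x, AEStronglyMeasurable fun y => g y * Real.exp (x * y) := fun x => (hg x).1
  have hb := (((hg (x + 1)).norm.add (hg (x - 1)).norm).add ((hg x).norm.const_mul |a|))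
  refine hb.mono' ?_ (Filter.Eventually.of_forall fun y => ?_)
  · have : (fun y => g y * (y - a) * Real.exp (x * y)) =
        fun y => (g y * Real.exp (x * y)) * (y - a) := by ext; ring
    rw [this]
    exact (hm x).mul (by fun_prop)
  · simp only [Pi.add_apply, Real.norm_eq_abs, abs_mul, Real.abs_exp]
    have h1 : Real.exp ((x + 1) * y) = Real.exp (x * y) * Real.exp y := by
      rw [← Real.exp_add]; ring_nf
    have h2 : Real.exp ((x - 1) * y) = Real.exp (x * y) * Real.exp (-y) := by
      rw [← Real.exp_add]; ring_nf
    rw [h1, h2]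
    have h3 : |y| ≤ Real.exp y + Real.exp (-y) := by
      rcases abs_cases y with h | h <;> rw [h.1]
      · linarith [Real.add_one_le_exp y, Real.exp_pos (-y)]
      · linarith [Real.add_one_le_exp (-y), Real.exp_pos y]
    have h4 : |y - a| ≤ Real.exp y + Real.exp (-y) + |a| := (abs_sub y a).trans (by linarith)
    have h5 : 0 ≤ |g y| * Real.exp (x * y) := by positivity
    nlinarith [mul_le_mul_of_nonneg_left h4 h5]

theorem hasDerivAt_integral_mul_exp {g : ℝ → ℝ}
    (hg : ∀ x, Integrable fun y => g y * Real.exp (x * y)) (x : ℝ) :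
    HasDerivAt (fun x => ∫ y, g y * Real.exp (x * y)) (∫ y, g y * y * Real.exp (x * y)) x := by
  have hg' : ∀ x, Integrable fun y => g y * y * Real.exp (x * y) := fun x => by
    simpa using integrable_sub_mul_exp hg 0 x
  refine (hasDerivAt_integral_of_dominated_loc_of_deriv_le (s := Set.Ioo (x - 1) (x + 1))
    (F := fun x y => g y * Real.exp (x * y))
    (F' := fun x y => g y * y * Real.exp (x * y))
    (bound := fun y => |g y * y * Real.exp ((x + 1) * y)| + |g y * y * Real.exp ((x - 1) * y)|)
    (Ioo_mem_nhds (by linarith) (by linarith)) (Filter.Eventually.of_forall fun x => (hg x).1)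
    (hg x) (hg' x).1 (Filter.Eventually.of_forall fun y t ht => ?_)
    ((hg' _).norm.add (hg' _).norm) (Filter.Eventually.of_forall fun y t _ => ?_)).2
  · rw [Real.norm_eq_abs]
    simp only [abs_mul, Real.abs_exp]
    rw [← mul_add]
    refine mul_le_mul_of_nonneg_left ?_ (by positivity)
    rcases le_total 0 y with hy | hy
    · refine le_add_of_le_of_nonneg (Real.exp_le_exp.2 ?_) (Real.exp_pos _).le
      exact mul_le_mul_of_nonneg_right ht.2.le hy
    · refine le_add_of_nonneg_of_le (Real.exp_pos _).le (Real.exp_le_exp.2 ?_)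
      exact mul_le_mul_of_nonpos_right ht.1.le hy
  · have h := ((hasDerivAt_id t).mul_const y).exp.const_mul (g y)
    refine h.congr_deriv ?_
    simp only [id]
    ring

/-- **Descartes' rule of signs** for the sum of the Laplace transform of `g` and of an exponential
polynomial whose frequencies are among the sign changes of `g`. -/
theorem card_zeros_laplace_le {ι : Type*} (D : Finset ι) (c : ι → ℝ) (M : Multiset ℝ) :
    ∀ (g : ℝ → ℝ) (w : ι → ℝ), (∀ x, Integrable fun y => g y * Real.exp (x * y)) →
      (∀ y, 0 ≤ g y * (M.map (y - ·)).prod) →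
      ¬ (fun y => g y * (M.map (y - ·)).prod) =ᵐ[volume] 0 →
      (∀ j ∈ D, w j * (M.map (c j - ·)).prod = 0) →
      ∀ Z : Finset ℝ,
        (∀ x ∈ Z, (∫ y, g y * Real.exp (x * y)) + ∑ j ∈ D, w j * Real.exp (x * c j) = 0) →
        Z.card ≤ M.card := by
  induction M using Multiset.induction_on with
  | empty =>
    intro g w hg hpos hne hw Z hZ
    simp only [Multiset.map_zero, Multiset.prod_zero, mul_one, Multiset.card_zero] at *
    -- Without sign changes `g ≥ 0` and all weights vanish, so a zero of the transform would force
    -- `g = 0` almost everywhere.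
    rw [Nat.le_zero, Finset.card_eq_zero, Finset.eq_empty_iff_forall_notMem]
    intro x hx
    have h := hZ x hx
    rw [Finset.sum_eq_zero fun j hj => by rw [hw j hj, zero_mul], add_zero,
      integral_eq_zero_iff_of_nonneg (fun y => mul_nonneg (hpos y) (Real.exp_pos _).le) (hg x)] at h
    refine hne (h.mono fun y hy => ?_)
    simpa [Real.exp_ne_zero] using hy
  | cons a M ih =>
    intro g w hg hpos hne hw Z hZ
    rw [Multiset.card_cons]
    by_contra hlt
    push Not at hlt
    obtain ⟨Z₀, hZ₀, hc₀⟩ := Finset.exists_subset_card_eq (Nat.succ_le_of_lt hlt)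
    set F : ℝ → ℝ := fun x => (∫ y, g y * Real.exp (x * y)) + ∑ j ∈ D, w j * Real.exp (x * c j)
    set F' : ℝ → ℝ := fun x => (∫ y, g y * (y - a) * Real.exp (x * y)) +
      ∑ j ∈ D, w j * (c j - a) * Real.exp (x * c j)
    -- Multiplying by `exp (-a x)` shifts all frequencies by `a`. Differentiation then moves the
    -- factor `y - a` from `M` into `g` and the weights, at the price of one zero by Rolle.
    have hderiv : ∀ x, HasDerivAt (fun x => F x * Real.exp (-(a * x)))
        (F' x * Real.exp (-(a * x))) x := by
      intro x
      have h1 := hasDerivAt_integral_mul_exp hg x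
      have h2 : HasDerivAt (fun x => ∑ j ∈ D, w j * Real.exp (x * c j))
          (∑ j ∈ D, w j * (c j * Real.exp (x * c j))) x := by
        refine HasDerivAt.fun_sum fun j _ => ?_
        have h := ((hasDerivAt_id x).mul_const (c j)).exp.const_mul (w j)
        refine h.congr_deriv ?_
        simp only [id]
        ring
      have h3 : HasDerivAt (fun x => Real.exp (-(a * x))) (-a * Real.exp (-(a * x))) x := by
        have h := (((hasDerivAt_id x).const_mul a).neg).exp
        refine h.congr_deriv ?_
        simp only [id, Pi.neg_apply]
        ring
      refine ((h1.add h2).mul h3).congr_deriv ?_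
      have h4 : (∫ y, g y * (y - a) * Real.exp (x * y)) =
          (∫ y, g y * y * Real.exp (x * y)) - a * ∫ y, g y * Real.exp (x * y) := by
        rw [← integral_const_mul, ← integral_sub
          (by simpa using integrable_sub_mul_exp hg 0 x) ((hg x).const_mul a)]
        congr 1; ext y; ring
      have h5 : ∑ j ∈ D, w j * (c j - a) * Real.exp (x * c j) =
          ∑ j ∈ D, w j * (c j * Real.exp (x * c j)) - a * ∑ j ∈ D, w j * Real.exp (x * c j) := by
        rw [Finset.mul_sum, ← Finset.sum_sub_distrib]
        exact Finset.sum_congr rfl fun j _ => by ring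
      simp only [F', h4, h5, Pi.add_apply]
      ring
    obtain ⟨Z', hZ', hc'⟩ := exists_finset_deriv_zero hderiv (m := M.card + 1) Z₀
      (fun x hx => by simp [F, hZ x (hZ₀ hx)]) hc₀
    have hle := ih (fun y => g y * (y - a)) (fun j => w j * (c j - a))
      (fun x => integrable_sub_mul_exp hg a x)
      (fun y => by simpa [mul_assoc] using hpos y)
      (by simpa [mul_assoc] using hne)
      (fun j hj => by simpa [mul_assoc] using hw j hj) Z'
      (fun x hx => by simpa [Real.exp_ne_zero] using hZ' x hx)
    omega

/-! ### Sign changes and superlevel sets -/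

theorem mul_pos_of_forall_ne_zero {u : ℝ → ℝ} (hu : Continuous u) {x y : ℝ} (hxy : x ≤ y)
    (h : ∀ t ∈ Set.Icc x y, u t ≠ 0) : 0 < u x * u y := by
  by_contra hlt
  push Not at hlt
  have hx := h x ⟨le_rfl, hxy⟩
  have hy := h y ⟨hxy, le_rfl⟩
  have : (0 : ℝ) ∈ u '' Set.Icc x y := by
    rcases lt_or_gt_of_ne hx with h1 | h1
    · exact intermediate_value_Icc hxy hu.continuousOn ⟨h1.le, by nlinarith [hy.lt_or_gt]⟩
    · exact intermediate_value_Icc' hxy hu.continuousOn ⟨by nlinarith [hy.lt_or_gt], h1.le⟩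
  obtain ⟨t, ht, h0⟩ := this
  exact h t ht h0

/-- A function that changes sign only at the points of a finite set `S` gets a constant sign after
multiplication by the linear factors of a subset of `S`. -/
theorem exists_finset_sign_const (S : Finset ℝ) : ∀ (v : ℝ → ℝ) (N : Set ℝ),
    (∀ x y, x ≤ y → x ∉ N → y ∉ N → (∀ t ∈ Set.Icc x y, t ∉ S) → 0 < v x * v y) → ↑S ⊆ N →
    ∃ T ⊆ S, ∀ x y, x ≤ y → x ∉ N → y ∉ N →
      0 < (v x * ∏ a ∈ T, (x - a)) * (v y * ∏ a ∈ T, (y - a)) := by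
  induction S using Finset.induction_on with
  | empty => exact fun v N h _ => ⟨∅, by simp, fun x y hxy hx hy => by simpa using h x y hxy hx hy⟩
  | insert z S hz ih =>
    intro v N h hN
    have hzN : z ∈ N := hN (by simp)
    have hSN : (S : Set ℝ) ⊆ N := fun s hs => hN (by simp [Finset.mem_coe.1 hs])
    have hS : ∀ x y, (z ∉ Set.Icc x y) → x ≤ y → x ∉ N → y ∉ N → (∀ t ∈ Set.Icc x y, t ∉ S) →
        0 < v x * v y := fun x y hzx hxy hx hy hs => h x y hxy hx hy fun t ht hts => by
      rcases Finset.mem_insert.1 hts with rfl | h'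
      · exact hzx ht
      · exact hs t ht h'
    have hside : ∀ x x', (x < z ∧ x' < z ∨ z < x ∧ z < x') → x ∉ N → x' ∉ N →
        (∀ t, x ≤ t ∧ t ≤ x' ∨ x' ≤ t ∧ t ≤ x → t ∉ S) → 0 < v x * v x' := by
      intro x x' hxx hx hx' hs
      have hzz : z ∉ Set.Icc x x' ∧ z ∉ Set.Icc x' x := by
        simp only [Set.mem_Icc, not_and_or, not_le]
        rcases hxx with h | h <;> simp [h]
      rcases le_total x x' with h | h
      · exact hS x x' hzz.1 h hx hx' fun t ht => hs t (Or.inl ht)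
      · rw [mul_comm]
        exact hS x' x hzz.2 h hx' hx fun t ht => hs t (Or.inr ht)
    -- Whether `v` changes sign across `z` does not depend on the points, close enough to `z`, at
    -- which it is tested.
    have key : ∀ x y x' y', x < z → z < y → x' < z → z < y' → x ∉ N → y ∉ N → x' ∉ N → y' ∉ N →
        (∀ t ∈ Set.Icc x y, t ∉ S) → (∀ t ∈ Set.Icc x' y', t ∉ S) →
        0 < (v x * v y) * (v x' * v y') := by
      intro x y x' y' hx hy hx' hy' hxN hyN hx'N hy'N hs hs'
      have h1 := hside x x' (Or.inl ⟨hx, hx'⟩) hxN hx'N fun t ht => by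
        rcases ht with h | h
        · exact hs t ⟨h.1, by linarith⟩
        · exact hs' t ⟨h.1, by linarith⟩
      have h2 := hside y y' (Or.inr ⟨hy, hy'⟩) hyN hy'N fun t ht => by
        rcases ht with h | h
        · exact hs' t ⟨by linarith, h.2⟩
        · exact hs t ⟨by linarith, h.2⟩
      nlinarith [mul_pos h1 h2]
    -- If `v` changes sign at `z`, the factor `x - z` repairs it and `z` joins `T`; otherwise `z`
    -- can be dropped.
    by_cases hch : ∃ x y, x < z ∧ z < y ∧ x ∉ N ∧ y ∉ N ∧ (∀ t ∈ Set.Icc x y, t ∉ S) ∧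
        v x * v y < 0
    · obtain ⟨x₀, y₀, hx₀, hy₀, hx₀N, hy₀N, hs₀, hneg⟩ := hch
      obtain ⟨T, hT, hTp⟩ := ih (fun x => v x * (x - z)) N (fun x y hxy hx hy hs => by
        have hxz : x ≠ z := fun h => hx (h ▸ hzN)
        have hyz : y ≠ z := fun h => hy (h ▸ hzN)
        by_cases hzx : z ∈ Set.Icc x y
        · have h1 := lt_of_le_of_ne hzx.1 hxz
          have h2 := lt_of_le_of_ne hzx.2 hyz.symm
          have h3 := key x y x₀ y₀ h1 h2 hx₀ hy₀ hx hy hx₀N hy₀N hs hs₀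
          have h4 : v x * v y < 0 := by
            by_contra h; push Not at h; nlinarith
          have h5 : 0 < (z - x) * (y - z) := mul_pos (by linarith) (by linarith)
          nlinarith
        · have h1 := hS x y hzx hxy hx hy hs
          have h2 : 0 < (x - z) * (y - z) := by
            rcases lt_or_gt_of_ne hxz with h | h
            · rw [Set.mem_Icc, not_and, not_le] at hzx
              exact mul_pos_of_neg_of_neg (by linarith) (by linarith [hzx h.le])
            · exact mul_pos (by linarith) (by linarith)
          nlinarith [mul_pos h1 h2]) hSN
      have hzT : z ∉ T := fun h => hz (hT h)
      refine ⟨insert z T, Finset.insert_subset_insert _ hT, fun x y hxy hx hy => ?_⟩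
      have h := hTp x y hxy hx hy
      have he : ∀ q, v q * ∏ a ∈ insert z T, (q - a) = v q * (q - z) * ∏ a ∈ T, (q - a) :=
        fun q => by rw [Finset.prod_insert hzT, mul_assoc]
      rwa [he, he]
    · push Not at hch
      obtain ⟨T, hT, hTp⟩ := ih v N (fun x y hxy hx hy hs => by
        by_cases hzx : z ∈ Set.Icc x y
        · have hself : ∀ q, q ∉ N → 0 < v q * v q := fun q hq =>
            h q q le_rfl hq hq fun t ht hts => hq (by
              obtain rfl : t = q := le_antisymm ht.2 ht.1
              exact hN hts)
          have h1 := lt_of_le_of_ne hzx.1 fun h => hx (h ▸ hzN)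
          have h2 := lt_of_le_of_ne hzx.2 fun h => hy (h ▸ hzN)
          refine lt_of_le_of_ne (hch x y h1 h2 hx hy hs) fun h0 => ?_
          have h3 := mul_pos (hself x hx) (hself y hy)
          nlinarith
        · exact hS x y hzx hxy hx hy hs) hSN
      exact ⟨T, hT.trans (Finset.subset_insert _ _), hTp⟩

/-- A continuous function that is negative near `±∞` and has at most `2 * m` zeros is non-positive
after multiplication by suitable `2 * m` linear factors. -/
theorem exists_multiset_mul_prod_nonpos {u : ℝ → ℝ} (hu : Continuous u) {m : ℕ}
    (hbot : ∀ᶠ x in Filter.atBot, u x < 0) (htop : ∀ᶠ x in Filter.atTop, u x < 0) (S : Finset ℝ)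
    (hS : ∀ x, u x = 0 ↔ x ∈ S) (hc : S.card ≤ 2 * m) :
    ∃ M : Multiset ℝ, M.card = 2 * m ∧ ∀ x, u x * (M.map (x - ·)).prod ≤ 0 := by
  obtain ⟨T, hT, hTp⟩ := exists_finset_sign_const S u S (fun x y hxy _ _ h =>
    mul_pos_of_forall_ne_zero hu hxy fun t ht h0 => h t ht ((hS t).1 h0)) subset_rfl
  obtain ⟨A, hA⟩ := Filter.eventually_atBot.1 hbot
  obtain ⟨B, hB⟩ := Filter.eventually_atTop.1 htop
  obtain ⟨a, haS⟩ := S.bddBelow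
  obtain ⟨b, hbS⟩ := S.bddAbove
  set x₀ := min (min A (a - 1)) (min B (b + 1)) with hx₀
  set x₁ := max (max A (a - 1)) (max B (b + 1)) with hx₁
  have hx₀A : x₀ ≤ A := (min_le_left _ _).trans (min_le_left _ _)
  have hx₀a : x₀ ≤ a - 1 := (min_le_left _ _).trans (min_le_right _ _)
  have hx₁B : B ≤ x₁ := (le_max_left _ _).trans (le_max_right _ _)
  have hx₁b : b + 1 ≤ x₁ := (le_max_right _ _).trans (le_max_right _ _)
  have h01 : x₀ ≤ x₁ := hx₀A.trans ((le_max_left _ _).trans (le_max_left _ _))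
  have h0S : x₀ ∉ S := fun h => by linarith [haS h]
  have h1S : x₁ ∉ S := fun h => by linarith [hbS h]
  have hu0 := hA x₀ hx₀A
  have hu1 := hB x₁ hx₁B
  have hp1 : 0 < ∏ a ∈ T, (x₁ - a) := Finset.prod_pos fun t ht => by linarith [hbS (hT ht)]
  have hp0 : 0 < (-1) ^ T.card * ∏ a ∈ T, (x₀ - a) := by
    rw [← Finset.prod_const, ← Finset.prod_mul_distrib]
    exact Finset.prod_pos fun t ht => by linarith [haS (hT ht)]
  have hpos := hTp x₀ x₁ h01 h0S h1S
  -- Equal signs of `u` at both far ends force an even number of sign changes.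
  have heven : Even T.card := by
    by_contra hodd
    rw [Nat.not_even_iff_odd] at hodd
    rw [hodd.neg_one_pow] at hp0
    have h1 : 0 < (u x₀ * u x₁) * (∏ a ∈ T, (x₁ - a)) := by
      have := mul_pos_of_neg_of_neg hu0 hu1
      positivity
    nlinarith [mul_pos h1 hp0]
  obtain ⟨r, hr⟩ := heven
  have hrm : T.card ≤ 2 * m := (Finset.card_le_card hT).trans hc
  -- Padding by an even power of `x` reaches `2 * m` factors without affecting the sign.
  refine ⟨T.val + Multiset.replicate (2 * (m - r)) 0, ?_, fun x => ?_⟩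
  · rw [Multiset.card_add, Multiset.card_replicate, Finset.card_val]
    omega
  · rw [Multiset.map_add, Multiset.prod_add, Multiset.map_replicate, Multiset.prod_replicate,
      pow_mul, ← mul_assoc]
    refine mul_nonpos_of_nonpos_of_nonneg ?_ (by positivity)
    change u x * ∏ a ∈ T, (x - a) ≤ 0
    by_cases hxS : x ∈ S
    · rw [(hS x).2 hxS, zero_mul]
    have hneg : u x₁ * ∏ a ∈ T, (x₁ - a) < 0 := mul_neg_of_neg_of_pos hu1 hp1
    rcases le_total x x₁ with h | h
    · have := hTp x x₁ h hxS h1S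
      nlinarith
    · have := hTp x₁ x h h1S hxS
      nlinarith

/-- The sublevel set at `0` of a product of `2 * k` linear factors is a union of `k` intervals. -/
theorem isUnionOfIntervals_prod_nonpos (k : ℕ) : ∀ M : Multiset ℝ, M.card = 2 * k →
    IsUnionOfIntervals k {x | (M.map (x - ·)).prod ≤ 0} := by
  induction k with
  | zero =>
    intro M hM
    rw [mul_zero, Multiset.card_eq_zero] at hM
    subst hM
    exact ⟨fun _ => ∅, fun i => i.elim0, by ext; simp⟩
  | succ k ih =>
    have hmax : ∀ M : Multiset ℝ, 0 < M.card → ∃ b N, M = b ::ₘ N ∧ ∀ a ∈ N, a ≤ b := by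
      intro M hM
      obtain ⟨b, hb, hbm⟩ := M.toFinset.exists_max_image id
        (by simpa using Multiset.card_pos.1 hM)
      obtain ⟨N, rfl⟩ := Multiset.exists_cons_of_mem (Multiset.mem_toFinset.1 hb)
      exact ⟨b, N, rfl, fun a ha => hbm a (by simp [ha])⟩
    intro M hM
    obtain ⟨b, N, rfl, hb⟩ := hmax M (by omega)
    rw [Multiset.card_cons] at hM
    -- With the two largest roots `a ≤ b` removed, the product of the rest is nonnegative from `a`
    -- on: `[a, b]` is one interval, and left of `a` the two factors do not change the sign.
    obtain ⟨a, N, rfl, ha⟩ := hmax N (by omega)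
    rw [Multiset.card_cons] at hM
    have hab : a ≤ b := hb a (by simp)
    obtain ⟨I, hI, hU⟩ := ih N (by omega)
    have hge : ∀ x, a ≤ x → 0 ≤ (N.map (x - ·)).prod := fun x hx =>
      Multiset.prod_nonneg fun t ht => by
        obtain ⟨c, hc, rfl⟩ := Multiset.mem_map.1 ht
        linarith [ha c hc]
    have hgt : ∀ x, b < x → 0 < (N.map (x - ·)).prod := fun x hx =>
      Multiset.prod_pos fun t ht => by
        obtain ⟨c, hc, rfl⟩ := Multiset.mem_map.1 ht
        linarith [ha c hc]
    refine ⟨Fin.cons (Set.Icc a b) fun i => I i ∩ Set.Iio a, ?_, ?_⟩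
    · intro i
      refine Fin.cases ?_ (fun i => ?_) i
      · exact Set.ordConnected_Icc
      · exact (hI i).inter Set.ordConnected_Iio
    · ext x
      have hx : x ∈ ⋃ i, I i ↔ (N.map (x - ·)).prod ≤ 0 := by rw [← hU]; rfl
      simp only [Multiset.map_cons, Multiset.prod_cons, Set.mem_ofPred_eq, Set.mem_iUnion,
        Fin.exists_fin_succ, Fin.cons_zero, Fin.cons_succ, Set.mem_inter_iff, exists_and_right]
      rw [← Set.mem_iUnion, hx, ← mul_assoc]
      rcases lt_or_ge x a with h | h
      · have : 0 < (x - b) * (x - a) := mul_pos_of_neg_of_neg (by linarith) (by linarith)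
        simp [h, not_le.2 h, mul_nonpos_iff_pos_imp_nonpos, this, this.le]
      · rcases le_or_gt x b with h' | h'
        · have : (x - b) * (x - a) ≤ 0 := mul_nonpos_of_nonpos_of_nonneg (by linarith) (by linarith)
          simp [h, h', mul_nonpos_of_nonpos_of_nonneg this (hge x h)]
        · have : 0 < (x - b) * (x - a) := mul_pos (by linarith) (by linarith)
          simp [not_lt.2 h, not_le.2 h', mul_pos this (hgt x h')]

/-! ### Superlevel sets of Gaussian mixtures -/

theorem continuous_gaussianPDFReal (m : ℝ) (v : ℝ≥0) : Continuous (gaussianPDFReal m v) := by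
  rw [gaussianPDFReal_def]
  exact continuous_const.mul (Real.continuous_exp.comp
    (((continuous_id.sub continuous_const).pow 2).neg.div_const _))

theorem tendsto_gaussianPDFReal_atTop (m : ℝ) {v : ℝ≥0} (hv : 0 < v) :
    Filter.Tendsto (gaussianPDFReal m v) Filter.atTop (nhds 0) := by
  rw [gaussianPDFReal_def, ← mul_zero (√(2 * Real.pi * v))⁻¹]
  refine Filter.Tendsto.const_mul _ (Real.tendsto_exp_atBot.comp ?_)
  have hv' : (0 : ℝ) < 2 * v := by positivity
  refine Filter.Tendsto.atBot_div_const hv' (Filter.tendsto_neg_atTop_atBot.comp ?_)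
  exact (Filter.tendsto_pow_atTop two_ne_zero).comp
    (Filter.tendsto_atTop_add_const_right _ (-m) Filter.tendsto_id)

theorem gaussianPDFReal_neg (m : ℝ) (v : ℝ≥0) (x : ℝ) :
    gaussianPDFReal m v (-x) = gaussianPDFReal (-m) v x := by
  simp only [gaussianPDFReal]
  congr 3
  ring

theorem tendsto_gaussianPDFReal_atBot (m : ℝ) {v : ℝ≥0} (hv : 0 < v) :
    Filter.Tendsto (gaussianPDFReal m v) Filter.atBot (nhds 0) := by
  have h := (tendsto_gaussianPDFReal_atTop (-m) hv).comp Filter.tendsto_neg_atBot_atTop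
  refine h.congr fun x => ?_
  rw [Function.comp, gaussianPDFReal_neg, neg_neg]

theorem gaussianPDFReal_comm (v : ℝ≥0) (x y : ℝ) :
    gaussianPDFReal x v y = gaussianPDFReal y v x := by
  simp only [gaussianPDFReal]
  congr 3
  ring

/-- Up to factors in `x` alone and `y` alone, the Gaussian kernel is `exp (x y / v)`; convolution
thus becomes a Laplace transform at `x / v`. -/
theorem gaussianPDFReal_eq_mul_exp {v : ℝ≥0} (hv : 0 < v) (x y : ℝ) :
    gaussianPDFReal y v x =
      gaussianPDFReal 0 v x * (Real.exp (-y ^ 2 / (2 * v)) * Real.exp (x / v * y)) := by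
  simp only [gaussianPDFReal]
  rw [← Real.exp_add, mul_assoc (√(2 * Real.pi * v))⁻¹, ← Real.exp_add]
  congr 2
  have : (v : ℝ) ≠ 0 := by positivity
  field_simp
  ring

/-- The product of two Gaussian densities, completed to a square. -/
theorem gaussianPDFReal_mul_gaussianPDFReal {v v₀ : ℝ≥0} (hv : 0 < v) (hv₀ : 0 < v₀)
    (m x y : ℝ) : gaussianPDFReal m v y * gaussianPDFReal y v₀ x =
      gaussianPDFReal m (v + v₀) x *
        gaussianPDFReal ((m * v₀ + x * v) / (v + v₀)) (v * v₀ / (v + v₀)) y := by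
  simp only [gaussianPDFReal]
  have h1 : (v : ℝ) ≠ 0 := by positivity
  have h2 : (v₀ : ℝ) ≠ 0 := by positivity
  have h3 : (v + v₀ : ℝ) ≠ 0 := by positivity
  have hπ := Real.pi_pos
  rw [mul_mul_mul_comm, mul_mul_mul_comm (√(2 * Real.pi * (v + v₀ : ℝ≥0)))⁻¹, ← Real.exp_add,
    ← Real.exp_add, ← mul_inv, ← mul_inv, ← Real.sqrt_mul (by positivity),
    ← Real.sqrt_mul (by positivity)]
  push_cast
  congr 1
  · congr 2
    field_simp
  · congr 1
    field_simp
    ring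

/-- The weighted sum of the Gaussian densities with indices in `s`. -/
noncomputable def gaussianSum {ι : Type*} (s : Finset ι) (w : ι → ℝ≥0) (m : ι → ℝ)
    (v : ι → ℝ≥0) (x : ℝ) : ℝ := ∑ j ∈ s, w j * gaussianPDFReal (m j) (v j) x

section

variable {ι : Type*} {s : Finset ι} {w : ι → ℝ≥0} {m : ι → ℝ} {v : ι → ℝ≥0}

theorem continuous_gaussianSum : Continuous (gaussianSum s w m v) :=
  continuous_finsetSum _ fun _ _ => (continuous_gaussianPDFReal _ _).const_mul _

theorem eventually_gaussianSum_lt (hv : ∀ j ∈ s, 0 < v j) {t : ℝ} (ht : 0 < t) :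
    (∀ᶠ x in Filter.atBot, gaussianSum s w m v x < t) ∧
      ∀ᶠ x in Filter.atTop, gaussianSum s w m v x < t := by
  constructor
  · have h : Filter.Tendsto (gaussianSum s w m v) Filter.atBot (nhds (∑ j ∈ s, (w j : ℝ) * 0)) :=
      tendsto_finsetSum _ fun j hj => (tendsto_gaussianPDFReal_atBot _ (hv j hj)).const_mul _
    exact h.eventually_lt_const (by simpa using ht)
  · have h : Filter.Tendsto (gaussianSum s w m v) Filter.atTop (nhds (∑ j ∈ s, (w j : ℝ) * 0)) :=
      tendsto_finsetSum _ fun j hj => (tendsto_gaussianPDFReal_atTop _ (hv j hj)).const_mul _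
    exact h.eventually_lt_const (by simpa using ht)

/-- Convolution with `N(0, v₀)` adds `v₀` to each variance and fixes constants. -/
theorem gaussianSum_conv {v₀ : ℝ≥0} (hv : ∀ j ∈ s, 0 < v j) (hv₀ : 0 < v₀) (t x : ℝ) :
    Integrable (fun y => (t - gaussianSum s w m v y) * gaussianPDFReal y v₀ x) ∧
      ∫ y, (t - gaussianSum s w m v y) * gaussianPDFReal y v₀ x =
        t - gaussianSum s w m (fun j => v j + v₀) x := by
  have hj : ∀ j ∈ s, Integrable
      (fun y => w j * (gaussianPDFReal (m j) (v j) y * gaussianPDFReal y v₀ x)) := fun j hj => by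
    simp_rw [gaussianPDFReal_mul_gaussianPDFReal (hv j hj) hv₀]
    exact ((integrable_gaussianPDFReal _ _).const_mul _).const_mul _
  have h0 : Integrable (fun y => t * gaussianPDFReal y v₀ x) := by
    simp_rw [gaussianPDFReal_comm v₀ _ x]
    exact (integrable_gaussianPDFReal _ _).const_mul _
  have he : (fun y => (t - gaussianSum s w m v y) * gaussianPDFReal y v₀ x) = fun y =>
      t * gaussianPDFReal y v₀ x -
        ∑ j ∈ s, w j * (gaussianPDFReal (m j) (v j) y * gaussianPDFReal y v₀ x) := by
    ext y
    simp only [gaussianSum, sub_mul, Finset.sum_mul, mul_assoc]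
  rw [he]
  refine ⟨h0.sub (integrable_finsetSum _ hj), ?_⟩
  rw [integral_sub h0 (integrable_finsetSum _ hj), integral_finsetSum _ hj]
  congr 1
  · simp_rw [gaussianPDFReal_comm v₀ _ x]
    rw [integral_const_mul, integral_gaussianPDFReal_eq_one _ hv₀.ne', mul_one]
  · refine Finset.sum_congr rfl fun j hjs => ?_
    have hv' := hv j hjs
    simp_rw [gaussianPDFReal_mul_gaussianPDFReal hv' hv₀]
    rw [integral_const_mul, integral_const_mul, integral_gaussianPDFReal_eq_one, mul_one]
    positivity

/-- A weighted sum of `k` Gaussian densities crosses a positive level at most `2 * k` times. -/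
theorem exists_multiset_gaussianSum_sub_mul_prod_nonpos (w : ι → ℝ≥0) (m : ι → ℝ) (s : Finset ι) :
    ∀ v : ι → ℝ≥0, (∀ j ∈ s, 0 < v j) → ∀ t : ℝ, 0 < t →
      {x | gaussianSum s w m v x = t}.Finite ∧ ∃ M : Multiset ℝ, M.card = 2 * s.card ∧
        ∀ x, (gaussianSum s w m v x - t) * (M.map (x - ·)).prod ≤ 0 := by
  classical
  induction s using Finset.strongInduction with
  | H s ih =>
  intro v hv t ht
  -- it suffices to bound the number of zeros
  suffices hZ : ∀ Z : Finset ℝ, (∀ x ∈ Z, gaussianSum s w m v x = t) → Z.card ≤ 2 * s.card by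
    have hfin : {x | gaussianSum s w m v x = t}.Finite := by
      by_contra hinf
      obtain ⟨Z, hZs, hZc⟩ := Set.Infinite.exists_subset_card_eq hinf (2 * s.card + 1)
      have := hZ Z fun x hx => hZs hx
      omega
    refine ⟨hfin, exists_multiset_mul_prod_nonpos (continuous_gaussianSum.sub continuous_const)
      ?_ ?_ hfin.toFinset ?_ (hZ _ fun x hx => by simpa using hx)⟩
    · exact (eventually_gaussianSum_lt hv ht).1.mono fun x hx => sub_neg.2 hx
    · exact (eventually_gaussianSum_lt hv ht).2.mono fun x hx => sub_neg.2 hx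
    · simp [sub_eq_zero]
  rcases s.eq_empty_or_nonempty with rfl | hne
  · intro Z hZ
    rw [Finset.card_empty, mul_zero, Nat.le_zero, Finset.card_eq_zero,
      Finset.eq_empty_iff_forall_notMem]
    intro x hx
    have := hZ x hx
    simp [gaussianSum] at this
    exact ht.ne this
  -- Deconvolve by the least variance: `D` collects the components that degenerate to atoms, `s'`
  -- those that remain Gaussian.
  obtain ⟨j₀, hj₀, hmin⟩ := s.exists_min_image v hne
  set v₀ := v j₀
  have hv₀ : 0 < v₀ := hv j₀ hj₀
  have hv₀' : (0 : ℝ) < v₀ := hv₀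
  set D := s.filter fun j => v j = v₀ with hD
  set s' := s.filter fun j => ¬ v j = v₀ with hs'
  set v' : ι → ℝ≥0 := fun j => v j - v₀
  have hv' : ∀ j ∈ s', 0 < v' j := fun j hj => by
    obtain ⟨hjs, hjv⟩ := Finset.mem_filter.1 hj
    exact tsub_pos_of_lt (lt_of_le_of_ne (hmin j hjs) (Ne.symm hjv))
  have hs's : s' ⊂ s := Finset.filter_ssubset.2 ⟨j₀, hj₀, by simp [v₀]⟩
  obtain ⟨-, M', hM'c, hM'⟩ := ih s' hs's v' hv' t ht
  -- Each atom enters as a double root: it annihilates the weight of the atom and leaves the sign of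
  -- the product unchanged.
  set M := M' + (D.val.map m + D.val.map m) with hM
  have hMprod : ∀ y : ℝ, (M.map (y - ·)).prod =
      (M'.map (y - ·)).prod * (∏ j ∈ D, (y - m j)) ^ 2 := fun y => by
    rw [hM, Multiset.map_add, Multiset.map_add, Multiset.prod_add, Multiset.prod_add,
      Multiset.map_map, ← sq]
    rfl
  have hMcard : M.card = 2 * s.card := by
    have : D.card + s'.card = s.card := by
      convert Finset.card_filter_add_card_filter_not (s := s) fun j => v j = v₀
    rw [hM, Multiset.card_add, Multiset.card_add, Multiset.card_map, hM'c, Finset.card_val]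
    omega
  set g : ℝ → ℝ := fun y => (t - gaussianSum s' w m v' y) * Real.exp (-y ^ 2 / (2 * v₀)) with hg
  have hgpdf : ∀ x y, gaussianPDFReal 0 v₀ x * (g y * Real.exp (x / v₀ * y)) =
      (t - gaussianSum s' w m v' y) * gaussianPDFReal y v₀ x := fun x y => by
    rw [gaussianPDFReal_eq_mul_exp hv₀ x y]; ring
  have hpdf : ∀ x, gaussianPDFReal 0 v₀ x ≠ 0 := fun x =>
    (gaussianPDFReal_pos _ _ _ hv₀.ne').ne'
  have hint : ∀ x, Integrable fun y => g y * Real.exp (x * y) := fun x => by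
    have h := (gaussianSum_conv (w := w) (m := m) hv' hv₀ t (x * v₀)).1
    simp_rw [← hgpdf, mul_div_cancel_right₀ x hv₀'.ne'] at h
    exact (integrable_const_mul_iff (IsUnit.mk0 _ (hpdf _)) _).1 h
  set W : ι → ℝ := fun j => -(w j * Real.exp (-(m j) ^ 2 / (2 * v₀)))
  have hrep : ∀ x, t - gaussianSum s w m v x = gaussianPDFReal 0 v₀ x *
      ((∫ y, g y * Real.exp (x / v₀ * y)) + ∑ j ∈ D, W j * Real.exp (x / v₀ * m j)) := by
    intro x
    have h1 := (gaussianSum_conv (w := w) (m := m) hv' hv₀ t x).2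
    simp_rw [← hgpdf] at h1
    rw [integral_const_mul] at h1
    have h2 : gaussianSum s w m v x = gaussianSum s' w m (fun j => v' j + v₀) x +
        ∑ j ∈ D, w j * gaussianPDFReal (m j) v₀ x := by
      rw [gaussianSum, ← Finset.sum_filter_not_add_sum_filter s fun j => v j = v₀]
      congr 1
      · refine Finset.sum_congr rfl fun j hj => ?_
        change _ = (w j : ℝ) * gaussianPDFReal (m j) (v j - v₀ + v₀) x
        rw [tsub_add_cancel_of_le (hmin j (Finset.mem_filter.1 hj).1)]
      · refine Finset.sum_congr rfl fun j hj => ?_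
        rw [(Finset.mem_filter.1 hj).2]
    rw [mul_add, h1, h2, Finset.mul_sum, sub_add_eq_sub_sub, sub_eq_add_neg (_ - _),
      ← Finset.sum_neg_distrib]
    congr 1
    refine Finset.sum_congr rfl fun j _ => ?_
    rw [gaussianPDFReal_eq_mul_exp hv₀ x (m j)]
    simp only [W]
    ring
  intro Z hZ
  have hpos : ∀ y, 0 ≤ g y * (M.map (y - ·)).prod := fun y => by
    rw [hMprod, hg]
    have h := hM' y
    have h1 := Real.exp_pos (-y ^ 2 / (2 * v₀))
    have h2 : 0 ≤ (t - gaussianSum s' w m v' y) * (M'.map (y - ·)).prod := by linarith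
    calc 0 ≤ ((t - gaussianSum s' w m v' y) * (M'.map (y - ·)).prod) *
          (Real.exp (-y ^ 2 / (2 * v₀)) * (∏ j ∈ D, (y - m j)) ^ 2) := by positivity
      _ = _ := by ring
  have hnz : ¬ (fun y => g y * (M.map (y - ·)).prod) =ᵐ[volume] 0 := by
    intro h
    -- Far to the right, beyond all roots and where the sum is below `t`, the product is strictly
    -- positive.
    obtain ⟨R, hR⟩ := Filter.eventually_atTop.1 (eventually_gaussianSum_lt (w := w) (m := m) hv' ht).2
    obtain ⟨b, hb⟩ := M.toFinset.bddAbove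
    have hne' : ∃ᶠ y in ae volume, y ∈ Set.Ioi (max R b) :=
      frequently_ae_mem_iff.2 (by simp)
    obtain ⟨y, hy, h0⟩ := (hne'.and_eventually h).exists
    have hyR := (le_max_left R b).trans_lt hy
    have hyb := (le_max_right R b).trans_lt hy
    have h1 : 0 < g y := mul_pos (sub_pos.2 (hR y hyR.le)) (Real.exp_pos _)
    have h2 : 0 < (M.map (y - ·)).prod := Multiset.prod_pos fun c hc => by
      obtain ⟨a, ha, rfl⟩ := Multiset.mem_map.1 hc
      exact sub_pos.2 ((hb (by simpa using ha)).trans_lt hyb)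
    exact (mul_pos h1 h2).ne' h0
  have hle := card_zeros_laplace_le D m M g W hint hpos hnz (fun j hj => by
    rw [hMprod, Finset.prod_eq_zero hj (sub_self _)]; simp) (Z.image fun x => x / v₀) (by
    intro x' hx'
    obtain ⟨x, hx, rfl⟩ := Finset.mem_image.1 hx'
    have h := hrep x
    rw [hZ x hx, sub_self] at h
    exact (mul_eq_zero.1 h.symm).resolve_left (hpdf x))
  rw [Finset.card_image_of_injective _ fun a b h => (div_left_inj' hv₀'.ne').1 h, hMcard] at hle
  exact hle

end

/-! ### Sets of minimal volume -/

/-- The Neyman-Pearson lemma: superlevel sets of a density have minimal volume. -/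
theorem volume_superlevel_le {Q : Measure ℝ} [IsFiniteMeasure Q] {f : ℝ → ℝ} (hf : Measurable f)
    (hQ : Q = volume.withDensity fun x => ENNReal.ofReal (f x)) {t : ℝ} (ht : 0 < t) {C : Set ℝ}
    (hC : MeasurableSet C) (hle : Q {x | t < f x} ≤ Q C) : volume {x | t < f x} ≤ volume C := by
  set A := {x | t < f x}
  have hA : MeasurableSet A := measurableSet_lt measurable_const hf
  have h1 : Q (A \ C) ≤ Q (C \ A) := by
    rw [← measure_inter_add_sdiff A hC, ← measure_inter_add_sdiff C hA, Set.inter_comm C A] at hle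
    exact (ENNReal.add_le_add_iff_left (measure_ne_top _ _)).1 hle
  have h2 : ENNReal.ofReal t * volume (A \ C) ≤ Q (A \ C) := by
    rw [hQ, withDensity_apply _ (hA.diff hC), ← setLIntegral_const]
    exact setLIntegral_mono' (hA.diff hC) fun x hx => ENNReal.ofReal_le_ofReal (le_of_lt hx.1)
  have h3 : Q (C \ A) ≤ ENNReal.ofReal t * volume (C \ A) := by
    rw [hQ, withDensity_apply _ (hC.diff hA), ← setLIntegral_const]
    exact setLIntegral_mono' (hC.diff hA) fun x hx => ENNReal.ofReal_le_ofReal (not_lt.1 hx.2)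
  have h4 : volume (A \ C) ≤ volume (C \ A) :=
    (ENNReal.mul_le_mul_iff_right (by simpa using ht) ENNReal.ofReal_ne_top).1
      ((h2.trans h1).trans h3)
  rw [← measure_inter_add_sdiff A hC, ← measure_inter_add_sdiff C hA, Set.inter_comm C A]
  gcongr

theorem continuous_cdf {ρ : Measure ℝ} [IsProbabilityMeasure ρ] (h : ∀ t, ρ {t} = 0) :
    Continuous (cdf ρ) := by
  rw [continuous_iff_continuousAt]
  intro t
  rw [(monotone_cdf ρ).continuousAt_iff_leftLim_eq_rightLim, StieltjesFunction.rightLim_eq]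
  refine le_antisymm ((monotone_cdf ρ).leftLim_le le_rfl) ?_
  have h1 := StieltjesFunction.measure_singleton (cdf ρ) t
  rw [measure_cdf, h, eq_comm, ENNReal.ofReal_eq_zero] at h1
  linarith

/-- Positive level sets of `f` are null and `f > 0` holds `Q`-almost everywhere, so the law of `f`
under `Q` has no atoms and its distribution function takes the value `1 - b`. As `1 - b > 0`, this
happens at a positive level. -/
theorem exists_measure_superlevel_eq {Q : Measure ℝ} [IsProbabilityMeasure Q] {f : ℝ → ℝ}
    (hf : Measurable f) (hQ : Q = volume.withDensity fun x => ENNReal.ofReal (f x))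
    (hfin : ∀ t, 0 < t → {x | f x = t}.Finite) {b : ℝ} (hb : b ∈ Set.Ioo (0 : ℝ) 1) :
    ∃ t, 0 < t ∧ Q.real {x | t < f x} = b := by
  have hac : Q ≪ volume := hQ ▸ withDensity_absolutelyContinuous _ _
  have h0 : Q {x | f x ≤ 0} = 0 := by
    have hm : MeasurableSet {x | f x ≤ 0} := measurableSet_le hf measurable_const
    rw [hQ, withDensity_apply _ hm, setLIntegral_congr_fun (g := fun _ => 0) hm
      (fun x hx => ENNReal.ofReal_eq_zero.2 hx)]
    simp
  have : IsProbabilityMeasure (Q.map f) := Measure.isProbabilityMeasure_map hf.aemeasurable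
  have hcont : Continuous (cdf (Q.map f)) := continuous_cdf fun t => by
    rw [Measure.map_apply hf (measurableSet_singleton t)]
    rcases lt_or_ge 0 t with ht | ht
    · exact hac ((hfin t ht).measure_zero _)
    · exact measure_mono_null (fun x hx => le_of_eq_of_le hx ht) h0
  have hcdf : ∀ t, cdf (Q.map f) t = Q.real {x | f x ≤ t} := fun t => by
    rw [cdf_eq_real, map_measureReal_apply hf measurableSet_Iic]
    rfl
  have hle0 : ∀ t ≤ 0, cdf (Q.map f) t = 0 := fun t ht => by
    have hsub : {x | f x ≤ t} ⊆ {x | f x ≤ 0} := fun x (hx : f x ≤ t) => hx.trans ht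
    rw [hcdf, measureReal_def, measure_mono_null hsub h0]
    rfl
  obtain ⟨t, ht⟩ : 1 - b ∈ Set.range (cdf (Q.map f)) := by
    refine mem_range_of_exists_le_of_exists_ge hcont ⟨0, ?_⟩ ?_
    · rw [hle0 0 le_rfl]; linarith [hb.2]
    · have h := (tendsto_cdf_atTop (Q.map f)).eventually_const_lt (by linarith [hb.1] : 1 - b < 1)
      exact h.exists.imp fun _ => le_of_lt
  refine ⟨t, ?_, ?_⟩
  · by_contra hneg
    rw [hle0 t (not_lt.1 hneg)] at ht
    linarith [hb.2]
  · rw [hcdf] at ht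
    have h := probReal_compl_eq_one_sub (μ := Q)
      (s := {x | f x ≤ t}) (measurableSet_le hf measurable_const)
    have hc : {x | f x ≤ t}ᶜ = {x | t < f x} := by ext; simp
    rw [hc] at h
    linarith

theorem IsGaussianMixture.isProbabilityMeasure {k : ℕ} {Q : Measure ℝ}
    (hQ : IsGaussianMixture k Q) : IsProbabilityMeasure Q := by
  obtain ⟨w, m, v, hw, -, rfl⟩ := hQ
  constructor
  simp only [Measure.coe_finsetSum, Finset.sum_apply, Measure.smul_apply, measure_univ]
  simp only [ENNReal.smul_def, smul_eq_mul, mul_one]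
  rw [← ENNReal.ofNNReal_finsetSum, hw]
  rfl

theorem sum_smul_gaussianReal {k : ℕ} (w : Fin k → ℝ≥0) (m : Fin k → ℝ) {v : Fin k → ℝ≥0}
    (hv : ∀ j, 0 < v j) : ∑ j, w j • gaussianReal (m j) (v j) =
      volume.withDensity fun x => ENNReal.ofReal (gaussianSum Finset.univ w m v x) := by
  ext B hB
  rw [withDensity_apply _ hB]
  have h : ∀ x, ENNReal.ofReal (gaussianSum Finset.univ w m v x) =
      ∑ j, w j * gaussianPDF (m j) (v j) x := fun x => by
    rw [gaussianSum, ENNReal.ofReal_sum_of_nonneg fun j _ =>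
      mul_nonneg (w j).coe_nonneg (gaussianPDFReal_nonneg (m j) (v j) x)]
    refine Finset.sum_congr rfl fun j _ => ?_
    rw [ENNReal.ofReal_mul (w j).coe_nonneg, gaussianPDF, ENNReal.ofReal_coe_nnreal]
  simp_rw [h]
  rw [lintegral_finsetSum _ fun j _ => (measurable_gaussianPDF _ _).const_mul _]
  simp only [Measure.coe_finsetSum, Finset.sum_apply, Measure.smul_apply]
  refine Finset.sum_congr rfl fun j _ => ?_
  rw [lintegral_const_mul _ (measurable_gaussianPDF _ _), gaussianReal_of_var_ne_zero _ (hv j).ne',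
    withDensity_apply _ hB]
  rfl

/-- Some set of minimal volume among the sets of given measure under a Gaussian mixture with `k`
components is a union of `k` intervals. -/
theorem IsGaussianMixture.exists_isUnionOfIntervals {k : ℕ} {Q : Measure ℝ}
    (hQ : IsGaussianMixture k Q) {b : ℝ} (hb : b ∈ Set.Ioo (0 : ℝ) 1) :
    ∃ A : Set ℝ, IsUnionOfIntervals k A ∧ Q.real A = b ∧
      ∀ C, MeasurableSet C → b ≤ Q.real C → volume A ≤ volume C := by
  have hprob := hQ.isProbabilityMeasure
  obtain ⟨w, m, v, hw, hv, hQe⟩ := hQ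
  rw [sum_smul_gaussianReal w m hv] at hQe
  set f := gaussianSum Finset.univ w m v
  have hf : Measurable f := continuous_gaussianSum.measurable
  have hsign := exists_multiset_gaussianSum_sub_mul_prod_nonpos w m Finset.univ v fun j _ => hv j
  have hac : Q ≪ volume := hQe ▸ withDensity_absolutelyContinuous _ _
  obtain ⟨t, ht, htb⟩ := exists_measure_superlevel_eq hf hQe (fun t ht => (hsign t ht).1) hb
  obtain ⟨hfin, M, hM, hMs⟩ := hsign t ht
  rw [Finset.card_univ, Fintype.card_fin] at hM
  -- This set differs from the superlevel set only on the finite set of crossings and roots, which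
  -- is null for both measures.
  set A := {x : ℝ | (M.map (x - ·)).prod ≤ 0}
  have hAe : A =ᵐ[volume] {x | t < f x} := by
    have hnull : volume ({x | f x = t} ∪ (M.toFinset : Set ℝ)) = 0 :=
      (hfin.union M.toFinset.finite_toSet).measure_zero _
    have hae : ∀ᵐ x, x ∉ {x | f x = t} ∪ (M.toFinset : Set ℝ) := measure_eq_zero_iff_ae_notMem.1 hnull
    filter_upwards [hae] with x hx
    rw [Set.mem_union, not_or] at hx
    have h0 : (M.map (x - ·)).prod ≠ 0 := by
      rw [Ne, Multiset.prod_eq_zero_iff, Multiset.mem_map]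
      rintro ⟨a, ha, hxa⟩
      exact hx.2 (by rw [sub_eq_zero.1 hxa]; simpa using ha)
    have h1 : f x - t ≠ 0 := sub_ne_zero.2 hx.1
    have h2 := hMs x
    refine propext ⟨fun hA => ?_, fun hA => ?_⟩
    · have hA' : (M.map (x - ·)).prod < 0 := lt_of_le_of_ne hA h0
      change t < f x
      by_contra hlt
      have : f x - t < 0 := lt_of_le_of_ne (by linarith) h1
      exact absurd (mul_pos_of_neg_of_neg this hA') (not_lt.2 h2)
    · change (M.map (x - ·)).prod ≤ 0
      by_contra hlt
      exact absurd (mul_pos (sub_pos.2 hA) (not_le.1 hlt)) (not_lt.2 h2)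
  refine ⟨A, isUnionOfIntervals_prod_nonpos k M hM, ?_, fun C hC hle => ?_⟩
  · rw [measureReal_congr (hac.ae_eq hAe), htb]
  · rw [measure_congr hAe]
    refine volume_superlevel_le hf hQe ht hC ?_
    rw [← htb] at hle
    exact (ENNReal.toReal_le_toReal (measure_ne_top _ _) (measure_ne_top _ _)).1 hle

/-! ### Sums of random signs over unions of intervals -/

/-- The walk with steps `X`, reflected at both ends of `[0, c]`. -/
noncomputable def clampWalk (c : ℝ) (X : ℕ → ℝ) : ℕ → ℝ
  | 0 => 0
  | t + 1 => max 0 (min c (clampWalk c X t + X t))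

theorem clampWalk_nonneg {c : ℝ} (X : ℕ → ℝ) (t : ℕ) : 0 ≤ clampWalk c X t := by
  cases t with
  | zero => exact le_rfl
  | succ t => exact le_max_left _ _

theorem clampWalk_le {c : ℝ} (hc : 0 ≤ c) (X : ℕ → ℝ) (t : ℕ) : clampWalk c X t ≤ c := by
  cases t with
  | zero => exact hc
  | succ t => exact max_le hc (min_le_left _ _)

theorem clampWalk_congr {c : ℝ} {X X' : ℕ → ℝ} (t : ℕ) (h : ∀ i < t, X i = X' i) :
    clampWalk c X t = clampWalk c X' t := by
  induction t with
  | zero => rfl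
  | succ t ih =>
    rw [clampWalk, clampWalk, ih fun i hi => h i (by omega), h t (by omega)]

open Classical in
/-- The sum of the steps `X` over the times in `A`, penalized by `c` for every maximal run of
consecutive times in `A`, is dominated by a predictable transform of the walk. -/
theorem sum_indicator_le_clampWalk {c : ℝ} (hc : 0 < c) {X : ℕ → ℝ} (hX : ∀ i, X i ^ 2 = 1)
    (A : Set ℕ) (n : ℕ) :
    ∑ i ∈ Finset.range n, A.indicator X i ≤
      c * ((Finset.range n).filter fun i => i ∈ A ∧ ∀ j, j + 1 = i → j ∉ A).card + n / (2 * c) +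
        ∑ i ∈ Finset.range n, clampWalk c X i / c * X i := by
  set N : ℕ → ℕ := fun n =>
    ((Finset.range n).filter fun i => i ∈ A ∧ ∀ j, j + 1 = i → j ∉ A).card with hN
  set e := clampWalk c X with he
  have he0 : ∀ t, 0 ≤ e t := clampWalk_nonneg X
  have hec : ∀ t, e t ≤ c := clampWalk_le hc.le X
  -- Potential argument with `e n ^ 2 / (2c)`, where an open run also carries the credit `c - e n`.
  -- The penalty `c` funds the credit when a run starts, and what the potential loses by clamping at
  -- `c` covers the steps inside the run.
  have key : ∀ n, (∑ i ∈ Finset.range n, A.indicator X i) +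
      (if (∃ j, j + 1 = n ∧ j ∈ A) then c - e n else 0) + e n ^ 2 / (2 * c) ≤
      c * N n + n / (2 * c) + ∑ i ∈ Finset.range n, e i / c * X i := by
    intro n
    induction n with
    | zero => simp [hN, he, clampWalk]
    | succ n ih =>
      have hNs : N (n + 1) = N n + if n ∈ A ∧ ∀ j, j + 1 = n → j ∉ A then 1 else 0 := by
        simp only [hN]
        rw [Finset.range_add_one, Finset.filter_insert]
        split_ifs with h
        · rw [Finset.card_insert_of_notMem (by simp)]
        · rfl
      have hes : e (n + 1) = max 0 (min c (e n + X n)) := rfl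
      have hprev : (∃ j, j + 1 = n + 1 ∧ j ∈ A) ↔ n ∈ A := by simp
      have h1 : (e n + X n) ^ 2 / (2 * c) = e n ^ 2 / (2 * c) + e n / c * X n + 1 / (2 * c) := by
        rw [add_sq, hX n]; field_simp
      rw [Finset.sum_range_succ, Finset.sum_range_succ, hNs]
      simp only [hprev]
      have h0 := he0 n
      have hcn := hec n
      have h3 : ((n + 1 : ℕ) : ℝ) / (2 * c) = n / (2 * c) + 1 / (2 * c) := by push_cast; ring
      rw [h3]
      push_cast
      -- how the potential changes under clamping
      have hdrop : e (n + 1) ^ 2 / (2 * c) + max 0 (e n + X n - c) ≤ (e n + X n) ^ 2 / (2 * c) := by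
        rw [← sub_nonneg]
        have : (e n + X n) ^ 2 / (2 * c) - (e (n + 1) ^ 2 / (2 * c) + max 0 (e n + X n - c)) =
          ((e n + X n) ^ 2 - e (n + 1) ^ 2 - 2 * c * max 0 (e n + X n - c)) / (2 * c) := by
          field_simp
          ring
        rw [this]
        refine div_nonneg ?_ (by positivity)
        rw [hes]
        rcases le_total (e n + X n) c with h | h
        · rw [min_eq_right h, max_eq_left (by linarith : e n + X n - c ≤ 0)]
          rcases le_total 0 (e n + X n) with h' | h'
          · rw [max_eq_right h']; linarith
          · rw [max_eq_left h']; nlinarith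
        · rw [min_eq_left h, max_eq_right hc.le, max_eq_right (by linarith)]
          nlinarith
      have hstep : e n + X n - max 0 (e n + X n - c) ≤ e (n + 1) := by
        rw [hes]
        rcases le_total (e n + X n) c with h | h
        · rw [min_eq_right h, max_eq_left (by linarith : e n + X n - c ≤ 0), sub_zero]
          exact le_max_right _ _
        · rw [min_eq_left h, max_eq_right hc.le, max_eq_right (by linarith)]
          linarith
      have hm0 : 0 ≤ max 0 (e n + X n - c) := le_max_left _ _
      by_cases hn : n ∈ A
      · simp only [Set.indicator_of_mem hn, hn, if_true, true_and]
        by_cases hp : ∃ j, j + 1 = n ∧ j ∈ A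
        · have hp' : ¬ ∀ j, j + 1 = n → j ∉ A := by push Not; exact hp
          rw [if_pos hp] at ih
          rw [if_neg hp']
          linarith
        · have hp' : ∀ j, j + 1 = n → j ∉ A := by push Not at hp; exact hp
          rw [if_neg hp] at ih
          rw [if_pos hp']
          linarith
      · simp only [Set.indicator_of_notMem hn, hn, if_false, false_and]
        split_ifs at ih <;> linarith
  refine le_trans ?_ (key n)
  have h4 : 0 ≤ e n ^ 2 / (2 * c) := by positivity
  split_ifs
  · linarith [hec n]
  · linarith

/-- The sign at `i` of the sign pattern that is `1` on `S` and `-1` off `S`. -/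
noncomputable def sgn {α : Type*} [DecidableEq α] (S : Finset α) (i : α) : ℝ :=
  if i ∈ S then 1 else -1

theorem sgn_sq {α : Type*} [DecidableEq α] (S : Finset α) (i : α) : sgn S i ^ 2 = 1 := by
  unfold sgn; split_ifs <;> norm_num

/-- The coefficient at time `i` lies in `[0, 1]` and depends only on earlier signs. Averaging over
the last sign therefore contributes a factor `cosh (r q) ≤ exp (r ^ 2 / 2)`. -/
theorem sum_exp_clampWalk_le {c : ℝ} (hc : 0 < c) (r : ℝ) (n : ℕ) :
    ∑ S ∈ (Finset.range n).powerset,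
      Real.exp (r * ∑ i ∈ Finset.range n, clampWalk c (sgn S) i / c * sgn S i) ≤
        2 ^ n * Real.exp (n * r ^ 2 / 2) := by
  induction n with
  | zero => simp
  | succ n ih =>
    rw [Finset.range_add_one, Finset.sum_powerset_insert (by simp), ← Finset.sum_add_distrib]
    have hins : ∀ S i, i < n → sgn (insert n S) i = sgn S i := fun S i hi => by
      simp [sgn, hi.ne]
    calc _ = ∑ S ∈ (Finset.range n).powerset,
          Real.exp (r * ∑ i ∈ Finset.range n, clampWalk c (sgn S) i / c * sgn S i) *
            (Real.exp (-(r * (clampWalk c (sgn S) n / c))) +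
              Real.exp (r * (clampWalk c (sgn S) n / c))) := by
          refine Finset.sum_congr rfl fun S hS => ?_
          have hnS : n ∉ S := fun h => by simpa using Finset.mem_powerset.1 hS h
          rw [Finset.sum_insert (by simp), Finset.sum_insert (by simp), mul_add, mul_add, mul_add,
            ← Real.exp_add, ← Real.exp_add, clampWalk_congr n (hins S)]
          congr 2
          · simp [sgn, hnS]; ring
          · have : ∑ i ∈ Finset.range n, clampWalk c (sgn (insert n S)) i / c * sgn (insert n S) i =
                ∑ i ∈ Finset.range n, clampWalk c (sgn S) i / c * sgn S i := by
              refine Finset.sum_congr rfl fun i hi => ?_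
              have hi' := Finset.mem_range.1 hi
              rw [hins S i hi', clampWalk_congr i fun j hj => hins S j (hj.trans hi')]
            rw [this]
            simp [sgn]; ring
      _ ≤ ∑ S ∈ (Finset.range n).powerset,
          Real.exp (r * ∑ i ∈ Finset.range n, clampWalk c (sgn S) i / c * sgn S i) *
            (2 * Real.exp (r ^ 2 / 2)) := by
          refine Finset.sum_le_sum fun S _ => mul_le_mul_of_nonneg_left ?_ (Real.exp_pos _).le
          set q := clampWalk c (sgn S) n / c
          have hq0 : 0 ≤ q := div_nonneg (clampWalk_nonneg _ _) hc.le
          have hq1 : q ≤ 1 := (div_le_one hc).2 (clampWalk_le hc.le _ _)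
          have h1 := Real.cosh_le_exp_half_sq (r * q)
          rw [Real.cosh_eq] at h1
          have h2 : Real.exp ((r * q) ^ 2 / 2) ≤ Real.exp (r ^ 2 / 2) := by
            refine Real.exp_le_exp.2 ?_
            have : q ^ 2 ≤ 1 := by nlinarith
            have : r ^ 2 * q ^ 2 ≤ r ^ 2 := by nlinarith [sq_nonneg r]
            nlinarith
          linarith
      _ ≤ _ := by
          rw [← Finset.sum_mul]
          refine (mul_le_mul_of_nonneg_right ih (by positivity)).trans (le_of_eq ?_)
          rw [pow_succ, mul_mul_mul_comm, ← Real.exp_add]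
          congr 2
          push_cast
          ring

/-- Along a monotone sequence, the number of visits to a union of `k` intervals is at most `k`. -/
theorem card_run_starts_le {k n : ℕ} {C : Set ℝ} (hC : IsUnionOfIntervals k C) {x : ℕ → ℝ}
    (hx : Monotone x) [DecidablePred fun i => x i ∈ C ∧ ∀ j, j + 1 = i → x j ∉ C] :
    ((Finset.range n).filter fun i => x i ∈ C ∧ ∀ j, j + 1 = i → x j ∉ C).card ≤ k := by
  obtain ⟨I, hI, rfl⟩ := hC
  rcases isEmpty_or_nonempty (Fin k) with hk | hk
  · simp
  have hl : ∀ i, x i ∈ ⋃ l, I l → ∃ l, x i ∈ I l := fun i hi => Set.mem_iUnion.1 hi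
  choose! l hl using hl
  -- If two runs started in the same interval, order-connectedness would put the point just before
  -- the second start in it too.
  have : ∀ i j, i < j → x i ∈ ⋃ l, I l → x j ∈ ⋃ l, I l → (∀ q, q + 1 = j → x q ∉ ⋃ l, I l) →
      l i ≠ l j := by
    intro i j hij hi hj hstart h
    refine hstart (j - 1) (by omega) (Set.mem_iUnion.2 ⟨l i, ?_⟩)
    exact (hI (l i)).out (hl i hi) (h ▸ hl j hj) ⟨hx (by omega), hx (by omega)⟩
  calc _ ≤ (Finset.univ : Finset (Fin k)).card := by
        refine Finset.card_le_card_of_injOn l (fun i _ => Finset.mem_coe.2 (Finset.mem_univ _)) ?_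
        intro i hi j hj h
        simp only [Finset.coe_filter, Set.mem_ofPred_eq] at hi hj
        rcases lt_trichotomy i j with hij | hij | hij
        · exact absurd h (this i j hij hi.2.1 hj.2.1 hj.2.2)
        · exact hij
        · exact absurd h.symm (this j i hij hj.2.1 hi.2.1 hi.2.2)
    _ = k := by simp

/-- Chernoff's bound in counting form, with the optimal parameter `r / n`. -/
theorem card_le_of_sum_exp_le {α : Type*} (s t : Finset α) (hts : t ⊆ s) (f : α → ℝ) {n : ℕ}
    (hn : 0 < n) {r B : ℝ} (hr : 0 ≤ r) (hf : ∀ x ∈ t, r ≤ f x)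
    (h : ∀ l : ℝ, ∑ x ∈ s, Real.exp (l * f x) ≤ B * Real.exp (n * l ^ 2 / 2)) :
    (t.card : ℝ) ≤ B * Real.exp (-(r ^ 2 / (2 * n))) := by
  have hn' : (0 : ℝ) < n := by exact_mod_cast hn
  have h1 : (t.card : ℝ) * Real.exp (r / n * r) ≤ B * Real.exp (n * (r / n) ^ 2 / 2) :=
    calc (t.card : ℝ) * Real.exp (r / n * r) = ∑ x ∈ t, Real.exp (r / n * r) := by
          rw [Finset.sum_const, nsmul_eq_mul]
      _ ≤ ∑ x ∈ t, Real.exp (r / n * f x) := Finset.sum_le_sum fun x hx =>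
          Real.exp_le_exp.2 (mul_le_mul_of_nonneg_left (hf x hx) (by positivity))
      _ ≤ ∑ x ∈ s, Real.exp (r / n * f x) :=
          Finset.sum_le_sum_of_subset_of_nonneg hts fun _ _ _ => (Real.exp_pos _).le
      _ ≤ _ := h _
  rw [← le_div_iff₀ (Real.exp_pos _), mul_div_assoc, ← Real.exp_sub] at h1
  refine h1.trans (le_of_eq ?_)
  congr 2
  field_simp
  ring

open Classical in
/-- Few sign patterns have a large sum over the sample points in some union of `k` intervals. -/
theorem card_sign_patterns_le {n k : ℕ} (hn : 0 < n) (hk : 0 < k) (y : Fin n → ℝ) {s : ℝ}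
    (hs : 3 / 2 * √(n * k) ≤ s) :
    ((Finset.univ.filter fun S : Finset (Fin n) => ∃ C, IsUnionOfIntervals k C ∧
      s ≤ ∑ i, sgn S i * C.indicator 1 (y i)).card : ℝ) ≤
        2 ^ n * Real.exp (-((s - 3 / 2 * √(n * k)) ^ 2 / (2 * n))) := by
  have hn' : (0 : ℝ) < n := by exact_mod_cast hn
  have hk' : (0 : ℝ) < k := by exact_mod_cast hk
  set σ := Tuple.sort y
  have hlt : ∀ i, min i (n - 1) < n := fun i => by omega
  -- The sorted sample, continued by its largest value; `φ` relabels sign patterns by rank.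
  set x : ℕ → ℝ := fun i => y (σ ⟨min i (n - 1), hlt i⟩) with hxdef
  have hx : Monotone x := fun i j hij =>
    Tuple.monotone_sort y (Fin.mk_le_mk.2 (min_le_min_right _ hij))
  have hxi : ∀ i : Fin n, x i = y (σ i) := fun i => by
    simp only [hxdef]
    congr 3
    have := i.2
    omega
  set φ : Finset (Fin n) → Finset ℕ := fun S =>
    S.map (σ.symm.toEmbedding.trans Fin.valEmbedding) with hφdef
  have hφinj : Function.Injective φ := Finset.map_injective _
  have hφ : ∀ S (i : Fin n), sgn (φ S) (i : ℕ) = sgn S (σ i) := fun S i => by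
    have : (i : ℕ) ∈ φ S ↔ σ i ∈ S := by
      simp only [hφdef, Finset.mem_map, Function.Embedding.trans_apply, Equiv.coe_toEmbedding,
        Fin.valEmbedding_apply]
      constructor
      · rintro ⟨j, hj, hji⟩
        rw [← Fin.ext hji, Equiv.apply_symm_apply]
        exact hj
      · exact fun h => ⟨σ i, h, by simp⟩
    simp only [sgn, this]
  -- This choice makes the penalty `c k` equal to `√(n k)` and the drift `n / (2c)` half of that,
  -- whence the factor `3 / 2`.
  set c := √(n / k)
  have hc : 0 < c := Real.sqrt_pos.2 (by positivity)
  have hck : c * k = √(n * k) := by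
    rw [eq_comm, Real.sqrt_eq_iff_mul_self_eq (by positivity) (by positivity)]
    have := Real.mul_self_sqrt (show (0 : ℝ) ≤ n / k by positivity)
    calc (n : ℝ) * k = (n / k) * (k * k) := by field_simp
      _ = c * k * (c * k) := by rw [← this]; ring
  have hnc : n / (2 * c) = √(n * k) / 2 := by
    have := Real.mul_self_sqrt (show (0 : ℝ) ≤ n / k by positivity)
    have h2 : (n : ℝ) = c * c * k := by rw [this]; field_simp
    rw [← hck, div_eq_div_iff (by positivity) (by positivity), h2]
    ring
  rw [← Finset.card_image_of_injective _ hφinj]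
  refine card_le_of_sum_exp_le (Finset.range n).powerset _ ?_
    (fun S => ∑ i ∈ Finset.range n, clampWalk c (sgn S) i / c * sgn S i) hn (by linarith) ?_
    fun l => sum_exp_clampWalk_le hc l n
  · intro S hS
    obtain ⟨S, -, rfl⟩ := Finset.mem_image.1 hS
    rw [Finset.mem_powerset]
    intro i hi
    obtain ⟨j, -, rfl⟩ := Finset.mem_map.1 hi
    simp
  · intro S hS
    obtain ⟨S, hS', rfl⟩ := Finset.mem_image.1 hS
    obtain ⟨C, hC, hsC⟩ := (Finset.mem_filter.1 hS').2
    have h1 := sum_indicator_le_clampWalk hc (fun i => sgn_sq (φ S) i) (x ⁻¹' C) n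
    have h2 : ∑ i, sgn S i * C.indicator 1 (y i) =
        ∑ i ∈ Finset.range n, (x ⁻¹' C).indicator (sgn (φ S)) i := by
      rw [← Fin.sum_univ_eq_sum_range fun i => (x ⁻¹' C).indicator (sgn (φ S)) i,
        ← Equiv.sum_comp σ]
      refine Finset.sum_congr rfl fun i _ => ?_
      simp only [Set.indicator, Set.mem_preimage, hxi, hφ]
      split_ifs <;> simp
    have h3 := card_run_starts_le (n := n) hC hx
    have h4 : c * ((Finset.range n).filter fun i => x i ∈ C ∧ ∀ j, j + 1 = i → x j ∉ C).card ≤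
        c * k := mul_le_mul_of_nonneg_left (by exact_mod_cast h3) hc.le
    rw [h2] at hsC
    simp only [Set.mem_preimage] at h1
    rw [hnc] at h1
    rw [hck] at h4
    linarith

/-! ### Uniform deviations over unions of intervals -/

open Classical in
/-- Symmetrization: a bound on the number of coordinatewise swaps of two samples that lead to `B`
bounds the probability of `B`. -/
theorem measure_pi_prod_le_of_card_le {n : ℕ} (P : Measure ℝ) [IsProbabilityMeasure P]
    {B : Set ((Fin n → ℝ) × (Fin n → ℝ))} (hB : MeasurableSet B) {q : ℝ≥0∞}
    (h : ∀ y y' : Fin n → ℝ, ((Finset.univ.filter fun S : Finset (Fin n) =>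
      ((fun i => if i ∈ S then y i else y' i), (fun i => if i ∈ S then y' i else y i)) ∈ B).card
        : ℝ≥0∞) ≤ q) :
    2 ^ n * ((Measure.pi fun _ : Fin n => P).prod (Measure.pi fun _ : Fin n => P)) B ≤ q := by
  set π := Measure.pi fun _ : Fin n => P
  set ρ := Measure.pi fun _ : Fin n => P.prod P
  set e := MeasurableEquiv.arrowProdEquivProdArrow ℝ ℝ (Fin n)
  have he : MeasurePreserving e ρ (π.prod π) :=
    measurePreserving_arrowProdEquivProdArrow ℝ ℝ (Fin n) (fun _ => P) (fun _ => P)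
  set T : Finset (Fin n) → (Fin n → ℝ × ℝ) → (Fin n → ℝ × ℝ) := fun S p i =>
    (if i ∈ S then id else Prod.swap) (p i)
  -- Swapping coordinates of two i.i.d. samples preserves their joint law, so `B` may be averaged
  -- over all `2 ^ n` swaps.
  have hT : ∀ S, MeasurePreserving (T S) ρ ρ := fun S => by
    refine measurePreserving_pi _ _ fun i => ?_
    split_ifs
    · exact MeasurePreserving.id _
    · exact Measure.measurePreserving_swap
  have hS : ∀ S, (π.prod π) B = ∫⁻ p, (e ∘ T S ⁻¹' B).indicator 1 p ∂ρ := fun S => by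
    have hm := he.comp (hT S)
    rw [lintegral_indicator_one (hm.measurable hB), hm.measure_preimage hB.nullMeasurableSet]
  calc 2 ^ n * (π.prod π) B = ∑ S : Finset (Fin n), (π.prod π) B := by
        rw [Finset.sum_const, Finset.card_univ, Fintype.card_finset, Fintype.card_fin, nsmul_eq_mul]
        push_cast
        rfl
    _ = ∑ S : Finset (Fin n), ∫⁻ p, (e ∘ T S ⁻¹' B).indicator 1 p ∂ρ :=
        Finset.sum_congr rfl fun S _ => hS S
    _ = ∫⁻ p, ∑ S : Finset (Fin n), (e ∘ T S ⁻¹' B).indicator 1 p ∂ρ := by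
        rw [lintegral_finsetSum _ fun S _ =>
          measurable_one.indicator ((he.comp (hT S)).measurable hB)]
    _ ≤ ∫⁻ _, q ∂ρ := by
        refine lintegral_mono fun p => ?_
        refine le_trans (le_of_eq ?_) (h (fun i => (p i).1) (fun i => (p i).2))
        simp only [Set.indicator_apply, Pi.one_apply]
        rw [Finset.sum_boole]
        congr 3
        ext S
        have : (e ∘ T S) p = ((fun i => if i ∈ S then (p i).1 else (p i).2),
            (fun i => if i ∈ S then (p i).2 else (p i).1)) := by
          refine Prod.ext (funext fun i => ?_) (funext fun i => ?_) <;>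
          · change _ = ite _ _ _
            simp only [e, T, Function.comp, MeasurableEquiv.arrowProdEquivProdArrow,
              MeasurableEquiv.coe_mk, Equiv.arrowProdEquivProdArrow, Equiv.coe_fn_mk]
            split_ifs <;> rfl
        rw [Set.mem_preimage, this]
    _ = q := by simp

/-- The union of the intervals with endpoints at the coordinates `a` and `b` of `y`. -/
def iccUnion {n k : ℕ} (a b : Fin k → Fin n) (y : Fin n → ℝ) : Set ℝ :=
  ⋃ l, Set.Icc (y (a l)) (y (b l))

theorem isUnionOfIntervals_iccUnion {n k : ℕ} (a b : Fin k → Fin n) (y : Fin n → ℝ) :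
    IsUnionOfIntervals k (iccUnion a b y) :=
  ⟨_, fun _ => Set.ordConnected_Icc, rfl⟩

theorem IsUnionOfIntervals.measurableSet {k : ℕ} {C : Set ℝ} (hC : IsUnionOfIntervals k C) :
    MeasurableSet C := by
  obtain ⟨I, hI, rfl⟩ := hC
  exact MeasurableSet.iUnion fun i => (hI i).measurableSet

theorem sampleCount_eq_sum {n : ℕ} (y : Fin n → ℝ) (C : Set ℝ) :
    (sampleCount y C : ℝ) = ∑ i, C.indicator 1 (y i) := by
  classical
  simp only [sampleCount, Set.indicator_apply, Pi.one_apply]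
  rw [Finset.sum_boole]

theorem measurable_iccUnion_indicator {n k : ℕ} (a b : Fin k → Fin n) :
    Measurable fun q : (Fin n → ℝ) × ℝ => (iccUnion a b q.1).indicator (1 : ℝ → ℝ) q.2 := by
  have hm : MeasurableSet {q : (Fin n → ℝ) × ℝ | q.2 ∈ iccUnion a b q.1} := by
    have : {q : (Fin n → ℝ) × ℝ | q.2 ∈ iccUnion a b q.1} =
        ⋃ l, ({q | q.1 (a l) ≤ q.2} ∩ {q | q.2 ≤ q.1 (b l)}) := by
      ext q; simp [iccUnion]
    rw [this]
    refine MeasurableSet.iUnion fun l => MeasurableSet.inter ?_ ?_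
    · exact measurableSet_le (by fun_prop) (by fun_prop)
    · exact measurableSet_le (by fun_prop) (by fun_prop)
  exact (measurable_one (α := ℝ)).indicator hm

/-- The pairs of samples for which the counts of some union of `k` intervals with endpoints in the
first sample differ by at least `s`. -/
def ghostSet (n k : ℕ) (s : ℝ) : Set ((Fin n → ℝ) × (Fin n → ℝ)) :=
  {p | ∃ a b : Fin k → Fin n,
    s ≤ sampleCount p.1 (iccUnion a b p.1) - sampleCount p.2 (iccUnion a b p.1)}

theorem measurableSet_ghostSet (n k : ℕ) (s : ℝ) : MeasurableSet (ghostSet n k s) := by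
  simp only [ghostSet, sampleCount_eq_sum, Set.ofPred_exists]
  refine MeasurableSet.iUnion fun a => MeasurableSet.iUnion fun b => ?_
  refine measurableSet_le measurable_const (Measurable.sub ?_ ?_)
  · refine Finset.measurable_fun_sum _ fun i _ => ?_
    exact (measurable_iccUnion_indicator a b).comp
      (f := fun p : (Fin n → ℝ) × (Fin n → ℝ) => (p.1, p.1 i)) (by fun_prop)
  · refine Finset.measurable_fun_sum _ fun i _ => ?_
    exact (measurable_iccUnion_indicator a b).comp
      (f := fun p : (Fin n → ℝ) × (Fin n → ℝ) => (p.1, p.2 i)) (by fun_prop)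

theorem measure_ghostSet_le {n k : ℕ} (hn : 0 < n) (hk : 0 < k) (P : Measure ℝ)
    [IsProbabilityMeasure P] {s : ℝ} (hs : 3 / 2 * √(n * k) ≤ s / 2) :
    ((Measure.pi fun _ : Fin n => P).prod (Measure.pi fun _ : Fin n => P)) (ghostSet n k s) ≤
      ENNReal.ofReal (2 * Real.exp (-((s / 2 - 3 / 2 * √(n * k)) ^ 2 / (2 * n)))) := by
  classical
  set x := Real.exp (-((s / 2 - 3 / 2 * √(n * k)) ^ 2 / (2 * n)))
  have hx : 0 < x := Real.exp_pos _
  have h := measure_pi_prod_le_of_card_le P (measurableSet_ghostSet n k s)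
    (q := 2 ^ n * ENNReal.ofReal (2 * x)) fun y y' => by
    set U := fun z : Fin n → ℝ => Finset.univ.filter fun S : Finset (Fin n) =>
      ∃ C, IsUnionOfIntervals k C ∧ s / 2 ≤ ∑ i, sgn S i * C.indicator 1 (z i)
    have hU : ∀ z, ((U z).card : ℝ) ≤ 2 ^ n * x := fun z => card_sign_patterns_le hn hk z hs
    set V := Finset.univ.filter fun S : Finset (Fin n) =>
      ((fun i => if i ∈ S then y i else y' i), (fun i => if i ∈ S then y' i else y i)) ∈
        ghostSet n k s
    -- The difference of counts splits into a signed sum over `y` and one over `y'` with opposite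
    -- signs; one of them reaches `s / 2`. Since `C` varies with `S`, the bound on sign patterns has
    -- to be uniform in `C`.
    have hV : V ⊆ U y ∪ (U y').image fun S => Sᶜ := by
      intro S hS
      obtain ⟨a, b, hab⟩ := (Finset.mem_filter.1 hS).2
      set C := iccUnion a b fun i => if i ∈ S then y i else y' i
      have hC : IsUnionOfIntervals k C := isUnionOfIntervals_iccUnion _ _ _
      have hsum : (sampleCount (fun i => if i ∈ S then y i else y' i) C : ℝ) -
          sampleCount (fun i => if i ∈ S then y' i else y i) C =
          (∑ i, sgn S i * C.indicator 1 (y i)) + ∑ i, sgn Sᶜ i * C.indicator 1 (y' i) := by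
        rw [sampleCount_eq_sum, sampleCount_eq_sum, ← Finset.sum_sub_distrib,
          ← Finset.sum_add_distrib]
        refine Finset.sum_congr rfl fun i _ => ?_
        by_cases hi : i ∈ S <;> simp [sgn, hi] <;> ring
      change s ≤ (sampleCount (fun i => if i ∈ S then y i else y' i) C : ℝ) -
          sampleCount (fun i => if i ∈ S then y' i else y i) C at hab
      rw [hsum] at hab
      rw [Finset.mem_union, Finset.mem_image]
      by_cases h1 : s / 2 ≤ ∑ i, sgn S i * C.indicator 1 (y i)
      · exact Or.inl (Finset.mem_filter.2 ⟨Finset.mem_univ _, C, hC, h1⟩)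
      · refine Or.inr ⟨Sᶜ, Finset.mem_filter.2 ⟨Finset.mem_univ _, C, hC, ?_⟩, compl_compl S⟩
        linarith [not_le.1 h1]
    have hVc : (V.card : ℝ) ≤ 2 ^ n * (2 * x) := by
      have h1 : (V.card : ℝ) ≤ (U y).card + (U y').card := by
        exact_mod_cast (Finset.card_le_card hV).trans ((Finset.card_union_le _ _).trans
          (Nat.add_le_add_left Finset.card_image_le _))
      linarith [hU y, hU y']
    calc (V.card : ℝ≥0∞) = ENNReal.ofReal V.card := (ENNReal.ofReal_natCast _).symm
      _ ≤ ENNReal.ofReal (2 ^ n * (2 * x)) := ENNReal.ofReal_le_ofReal hVc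
      _ = _ := by
        rw [ENNReal.ofReal_mul (by positivity), ENNReal.ofReal_pow (by norm_num)]
        simp
  exact (ENNReal.mul_le_mul_iff_right (by positivity) (by finiteness)).1 h

/-- Hoeffding's inequality for the number of sample points in a fixed set. -/
theorem measure_sampleCount_ge_le {n : ℕ} (hn : 0 < n) (P : Measure ℝ) [IsProbabilityMeasure P]
    {C : Set ℝ} (hC : MeasurableSet C) {η : ℝ} (hη : 0 ≤ η) :
    (Measure.pi fun _ : Fin n => P).real {y | n * (P.real C + η) ≤ sampleCount y C} ≤
      Real.exp (-(2 * n * η ^ 2)) := by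
  have hn' : (0 : ℝ) < n := by exact_mod_cast hn
  set π := Measure.pi fun _ : Fin n => P
  have hm : Measurable (C.indicator (1 : ℝ → ℝ)) := measurable_one.indicator hC
  -- Hoeffding's lemma: a variable with values in an interval of length `1` has parameter `(1 / 2) ^
  -- 2`.
  have hsub : HasSubgaussianMGF (fun t => C.indicator (1 : ℝ → ℝ) t - P.real C) (1 / 4) P := by
    have h := hasSubgaussianMGF_of_mem_Icc (μ := P) (a := 0) (b := 1) hm.aemeasurable
      (Filter.Eventually.of_forall fun t => by
        by_cases ht : t ∈ C <;> simp [ht])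
    rw [integral_indicator_one hC] at h
    convert h using 1
    norm_num
  have hind : iIndepFun (fun (i : Fin n) (y : Fin n → ℝ) =>
      C.indicator (1 : ℝ → ℝ) (y i) - P.real C) π :=
    iIndepFun_pi (X := fun _ t => C.indicator (1 : ℝ → ℝ) t - P.real C)
      fun _ => (hm.sub_const _).aemeasurable
  have h := HasSubgaussianMGF.measure_sum_ge_le_of_iIndepFun hind (s := Finset.univ)
    (c := fun _ => 1 / 4) (fun i _ => by
      have hmp : MeasurePreserving (Function.eval i) π P := measurePreserving_eval (fun _ => P) i
      have h : HasSubgaussianMGF (fun t => C.indicator (1 : ℝ → ℝ) t - P.real C) (1 / 4)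
          (π.map (Function.eval i)) := by rwa [hmp.map_eq]
      exact h.of_map hmp.measurable.aemeasurable) (ε := n * η) (by positivity)
  convert h using 2
  · ext y
    simp only [Set.mem_ofPred_eq, sampleCount_eq_sum, Finset.sum_sub_distrib, Finset.sum_const,
      Finset.card_univ, Fintype.card_fin, nsmul_eq_mul]
    constructor <;> intro h <;> linarith
  · simp only [Finset.sum_const, Finset.card_univ, Fintype.card_fin, nsmul_eq_mul]
    push_cast
    field_simp
    ring

/-- The empirical measure of a union of `k` intervals with endpoints in the sample exceeds its
probability by less than `δ`, uniformly, up to an event of small probability. -/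
theorem exists_uniform_deviation {n k : ℕ} (hn : 0 < n) (hk : 0 < k) (P : Measure ℝ)
    [IsProbabilityMeasure P] {δ : ℝ} (hδ : 0 ≤ δ) (hs : 3 / 2 * √(n * k) ≤ n * δ / 4)
    (hghost : Real.exp (-(n * δ ^ 2 / 2)) ≤ 1 / 2) :
    ∃ G : Set (Fin n → ℝ), MeasurableSet G ∧
      (Measure.pi fun _ : Fin n => P) G ≤
        ENNReal.ofReal (4 * Real.exp (-((n * δ / 4 - 3 / 2 * √(n * k)) ^ 2 / (2 * n)))) ∧
      ∀ y ∉ G, ∀ a b : Fin k → Fin n,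
        (sampleCount y (iccUnion a b y) : ℝ) < n * (P.real (iccUnion a b y) + δ) := by
  set π := Measure.pi fun _ : Fin n => P
  set B := ghostSet n k (n * δ / 2)
  have hB : MeasurableSet B := measurableSet_ghostSet _ _ _
  have hmeas : Measurable fun y => π (Prod.mk y ⁻¹' B) := measurable_measure_prodMk_left hB
  -- `G` consists of the samples that a fresh ghost sample contradicts with probability at least `1
  -- / 2`. Markov's inequality doubles the ghost bound.
  refine ⟨{y | 2⁻¹ ≤ π (Prod.mk y ⁻¹' B)}, measurableSet_le measurable_const hmeas, ?_, ?_⟩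
  · have h1 := mul_meas_ge_le_lintegral (μ := π) hmeas 2⁻¹
    rw [← Measure.prod_apply hB] at h1
    have h2 := measure_ghostSet_le hn hk P (s := n * δ / 2) (by linarith)
    have h3 := h1.trans h2
    rw [mul_comm, ← div_eq_mul_inv, ENNReal.div_le_iff (by norm_num) (by norm_num)] at h3
    refine h3.trans (le_of_eq ?_)
    rw [show (2 : ℝ≥0∞) = ENNReal.ofReal 2 by simp, ← ENNReal.ofReal_mul (by positivity)]
    congr 1
    rw [show n * δ / 2 / 2 = n * δ / 4 by ring]
    ring
  · intro y hy a b
    by_contra hlt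
    rw [not_lt] at hlt
    refine hy ?_
    set C := iccUnion a b y
    have hC : MeasurableSet C := (isUnionOfIntervals_iccUnion a b y).measurableSet
    set D := {y' : Fin n → ℝ | n * (P.real C + δ / 2) ≤ sampleCount y' C}
    have hD : MeasurableSet D := by
      simp only [D, sampleCount_eq_sum]
      refine measurableSet_le measurable_const (Finset.measurable_fun_sum _ fun i _ => ?_)
      exact (measurable_one.indicator hC).comp (measurable_pi_apply i)
    have hDle : π.real D ≤ 1 / 2 := by
      refine (measure_sampleCount_ge_le hn P hC (by positivity)).trans (le_trans (le_of_eq ?_) hghost)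
      congr 1; ring
    -- An excess of `n δ` in `y` leaves a gap of `n δ / 2` once the ghost count is within `n δ / 2`
    -- above its mean.
    have hsub : Dᶜ ⊆ Prod.mk y ⁻¹' B := by
      intro y' hy'
      have hy'' : (sampleCount y' C : ℝ) < n * (P.real C + δ / 2) := not_le.1 hy'
      refine ⟨a, b, ?_⟩
      change n * δ / 2 ≤ (sampleCount y C : ℝ) - sampleCount y' C
      linarith
    change 2⁻¹ ≤ π (Prod.mk y ⁻¹' B)
    refine le_trans ?_ (measure_mono hsub)
    rw [← ofReal_measureReal, probReal_compl_eq_one_sub hD, show (2⁻¹ : ℝ≥0∞) =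
      ENNReal.ofReal (1 / 2) by rw [one_div, ENNReal.ofReal_inv_of_pos (by norm_num)]; simp]
    exact ENNReal.ofReal_le_ofReal (by linarith)

/-! ### The guarantee of the dynamic program -/

theorem abs_measureReal_sub_le_tvDistance (P Q : Measure ℝ) [IsProbabilityMeasure P]
    [IsProbabilityMeasure Q] {B : Set ℝ} (hB : MeasurableSet B) :
    |P.real B - Q.real B| ≤ tvDistance P Q := by
  refine le_ciSup (f := fun B : {B : Set ℝ // MeasurableSet B} => |P.real B.1 - Q.real B.1|)
    ⟨1, ?_⟩ ⟨B, hB⟩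
  rintro _ ⟨B, rfl⟩
  have h1 := measureReal_le_one (μ := P) (s := B.1)
  have h2 := measureReal_le_one (μ := Q) (s := B.1)
  have h3 := measureReal_nonneg (μ := P) (s := B.1)
  have h4 := measureReal_nonneg (μ := Q) (s := B.1)
  exact abs_le.2 ⟨by linarith, by linarith⟩

theorem condDistrib_ae_eq_map_of_indepFun {Ω α : Type*} [MeasurableSpace Ω] [MeasurableSpace α]
    {μ : Measure Ω} [IsProbabilityMeasure μ] {X : Ω → α} {Y : Ω → ℝ} (hX : Measurable X)
    (hY : Measurable Y) (h : IndepFun X Y μ) :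
    ∀ᵐ x ∂μ.map X, condDistrib Y X μ x = μ.map Y := by
  have : IsProbabilityMeasure (μ.map Y) := Measure.isProbabilityMeasure_map hY.aemeasurable
  refine condDistrib_ae_eq_of_measure_eq_compProd (κ := Kernel.const α (μ.map Y)) X
    hY.aemeasurable ?_
  rw [(indepFun_iff_map_prod_eq_prod_map_map hX.aemeasurable hY.aemeasurable).1 h,
    Measure.compProd_const]

theorem sampleCount_add_compl {n : ℕ} (y : Fin n → ℝ) (C : Set ℝ) :
    (sampleCount y C : ℝ) + sampleCount y Cᶜ = n := by
  rw [sampleCount_eq_sum, sampleCount_eq_sum, ← Finset.sum_add_distrib]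
  calc _ = ∑ i : Fin n, (1 : ℝ) := by
        refine Finset.sum_congr rfl fun i _ => ?_
        by_cases h : y i ∈ C <;> simp [h]
    _ = n := by simp

theorem le_dpTarget {n : ℕ} {β γ : ℝ} (hγ : 0 < γ) : n * β ≤ dpTarget n β γ := by
  refine le_trans ?_ (Nat.le_ceil _)
  have h := Nat.le_ceil (β / γ)
  rw [div_le_iff₀ hγ] at h
  rw [mul_comm]
  exact mul_le_mul_of_nonneg_right h (Nat.cast_nonneg _)

/-- Rounding `β / γ` up costs at most one unit of `γ`. -/
theorem dpTarget_le {n m : ℕ} {β γ : ℝ} (hβ : 0 ≤ β) (hγ : 0 < γ)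
    (h : n * (β + γ) ≤ (m : ℝ)) : dpTarget n β γ ≤ m := by
  refine Nat.ceil_le.2 (le_trans ?_ h)
  have h1 := (Nat.ceil_lt_add_one (div_nonneg hβ hγ.le)).le
  have h2 := mul_le_mul_of_nonneg_right h1 hγ.le
  rw [add_mul, one_mul, div_mul_cancel₀ _ hγ.ne'] at h2
  rw [mul_comm]
  exact mul_le_mul_of_nonneg_left h2 (Nat.cast_nonneg _)

/-- The guarantee of the dynamic program on the event that the empirical measure is close to `P`
on the output and on a union `A` of `k` intervals. -/
theorem IsDPOutput.guarantee {n k : ℕ} {y : Fin n → ℝ} {α δ γ κ : ℝ} {P : Measure ℝ}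
    {A C : Set ℝ} (hn : 0 < n) (hk : 1 ≤ k) (hα : α < 1) (hδ : 0 < δ) (hγ : 0 < γ)
    (hknδ : (k : ℝ) ≤ n * δ / 2) (hA : IsUnionOfIntervals k A) (hPA : 1 - α + γ + 2 * δ ≤ κ)
    (hyA : n * (κ - δ / 2) ≤ sampleCount y A)
    (hy : ∀ a b : Fin k → Fin n,
      (sampleCount y (iccUnion a b y) : ℝ) < n * (P.real (iccUnion a b y) + δ))
    (hC : IsDPOutput y k (1 - α + δ) γ C) :
    IsUnionOfIntervals k C ∧ 1 - α ≤ P.real C ∧ volume C ≤ volume A := by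
  have hn' : (0 : ℝ) < n := by exact_mod_cast hn
  -- The level, the rounding loss `γ` and a spare `δ / 2`, which secures the `k` points needed to
  -- use every interval.
  have hcount : (n : ℝ) * (1 - α + δ + γ + δ / 2) ≤ sampleCount y A :=
    (mul_le_mul_of_nonneg_left (by linarith) hn'.le).trans hyA
  obtain ⟨a, b, rfl⟩ := hC.exists_eq_iUnion_Icc
  refine ⟨isUnionOfIntervals_iccUnion a b y, ?_, hC.volume_le hk hA ?_ ?_⟩
  · have h1 : ((dpTarget n (1 - α + δ) γ : ℕ) : ℝ) ≤ sampleCount y (iccUnion a b y) := by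
      exact_mod_cast hC.dpTarget_le_card
    have h2 := ((le_dpTarget hγ).trans h1).trans_lt (hy a b)
    have h3 := lt_of_mul_lt_mul_left h2 hn'.le
    change 1 - α ≤ P.real (iccUnion a b y)
    linarith
  · have h1 : (0 : ℝ) ≤ n * (1 - α + δ + γ) := by
      have : 0 < 1 - α := by linarith
      positivity
    have : (k : ℝ) ≤ sampleCount y A := by linarith
    exact_mod_cast this
  · refine dpTarget_le (by linarith) hγ (le_trans ?_ hcount)
    exact mul_le_mul_of_nonneg_left (by linarith) hn'.le

theorem theoremC1 :
    ∃ K : ℝ, 0 < K ∧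
      ∀ {Ω : Type*} [MeasurableSpace Ω] (μ : Measure Ω) [IsProbabilityMeasure μ]
        (P Pk : Measure ℝ) [IsProbabilityMeasure P]
        (n k : ℕ) (Y : Fin (n + 1) → Ω → ℝ) (α δ γ ε : ℝ),
        1 ≤ n → 1 ≤ k →
        -- the observations `Y 0, …, Y n` are i.i.d. with law `P`
        (∀ i, Measurable (Y i)) → iIndepFun Y μ → (∀ i, μ.map (Y i) = P) →
        -- `P` is within total variation distance `ε` of a Gaussian mixture with `k` components
        IsGaussianMixture k Pk → tvDistance Pk P ≤ ε →
        α ∈ Set.Ioo (0 : ℝ) 1 → δ ∈ Set.Ioo (0 : ℝ) 1 → γ ∈ Set.Ioo (0 : ℝ) 1 →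
        K * √(((k : ℝ) + Real.log n) / n) ≤ δ →
        γ + 2 * δ + 2 * ε < α →
        (∀ ω, ∃ C, IsDPOutput (fun i : Fin n => Y i.castSucc ω) k (1 - α + δ) γ C) ∧
        ∃ E : Set Ω, MeasurableSet E ∧ ENNReal.ofReal (1 - δ) ≤ μ E ∧
          ∀ ω ∈ E, ∀ C : Set ℝ,
            IsDPOutput (fun i : Fin n => Y i.castSucc ω) k (1 - α + δ) γ C →
              IsUnionOfIntervals k C ∧
              -- conditional probability of `Y n ∈ C` given the first `n` observations
              ENNReal.ofReal (1 - α) ≤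
                condDistrib (Y (Fin.last n)) (fun ω' (i : Fin n) => Y i.castSucc ω') μ
                  (fun i : Fin n => Y i.castSucc ω) C ∧
              volume C ≤ optVolume P (1 - α + γ + 2 * δ + 2 * ε) := by
  refine ⟨100, by norm_num, ?_⟩
  intro Ω _ μ _ P Pk _ n k Y α δ γ ε hn hk hYm hind hlaw hPk htv hα hδ hγ hK hslack
  have := hPk.isProbabilityMeasure
  have hn' : (1 : ℝ) ≤ n := by exact_mod_cast hn
  have hk' : (1 : ℝ) ≤ k := by exact_mod_cast hk
  have hlog : 0 ≤ Real.log n := Real.log_nonneg hn'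
  have hε : 0 ≤ ε := by
    have h := abs_measureReal_sub_le_tvDistance Pk P MeasurableSet.empty
    simp only [measureReal_empty, sub_zero, abs_zero] at h
    exact h.trans htv
  have hδ0 := hδ.1
  -- The lower bound on `δ`, squared; `10000` is the square of the universal constant.
  have hnδ2 : 10000 * ((k : ℝ) + Real.log n) ≤ n * δ ^ 2 := by
    have h := pow_le_pow_left₀ (by positivity) hK 2
    rw [mul_pow, Real.sq_sqrt (by positivity), ← mul_div_assoc, div_le_iff₀ (by linarith)] at h
    linarith
  have hnδ : n * δ ^ 2 ≤ n * δ := by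
    have : δ ^ 2 ≤ δ := by nlinarith [hδ.2]
    nlinarith
  have hδn : n * δ ≤ n := by nlinarith [hδ.2]
  have hsqrt : √((n : ℝ) * k) ≤ n * δ / 100 := by
    refine Real.sqrt_le_iff.2 ⟨by positivity, ?_⟩
    have h1 : (n : ℝ) * (10000 * k) ≤ n * (n * δ ^ 2) :=
      mul_le_mul_of_nonneg_left (by linarith) (by linarith)
    nlinarith
  -- all exponentially small terms are at most `δ / 16`
  have hexp : ∀ t : ℝ, n * δ ^ 2 / 128 ≤ t → Real.exp (-t) ≤ δ / 16 := by
    intro t ht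
    -- `10000 / 128 > 31` and `k ≥ 1`. This yields `exp (-t) ≤ 1 / (32 n)`, which is below `δ / 16`
    -- because `n δ ≥ 1 / 2`.
    have h1 : 31 + Real.log n ≤ t := by linarith
    have h2 : 32 * n ≤ Real.exp t := by
      calc 32 * (n : ℝ) ≤ Real.exp 31 * n :=
            mul_le_mul_of_nonneg_right (by linarith [Real.add_one_le_exp 31]) (by linarith)
        _ = Real.exp (31 + Real.log n) := by rw [Real.exp_add, Real.exp_log (by linarith)]
        _ ≤ _ := Real.exp_le_exp.2 h1
    rw [Real.exp_neg, inv_le_comm₀ (Real.exp_pos _) (by positivity), inv_div]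
    refine le_trans ?_ h2
    rw [div_le_iff₀ hδ0]
    linarith
  refine ⟨fun ω => exists_isDPOutput _ hk ?_ (dpTarget_le ?_ hγ.1 ?_), ?_⟩
  · have : (k : ℝ) ≤ n := by linarith
    exact_mod_cast this
  · linarith [hα.2]
  · have : 1 - α + δ + γ ≤ 1 := by linarith
    nlinarith
  set X : Ω → Fin n → ℝ := fun ω i => Y i.castSucc ω
  have hXm : Measurable X := measurable_pi_lambda _ fun i => hYm _
  set π := Measure.pi fun _ : Fin n => P
  have hXπ : μ.map X = π := by
    have h := (iIndepFun_iff_map_fun_eq_pi_map fun i : Fin n => (hYm i.castSucc).aemeasurable).1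
      (hind.precomp (Fin.castSucc_injective n))
    simp only [hlaw] at h
    exact h
  have hXY : IndepFun X (Y (Fin.last n)) μ := by
    have h := hind.indepFun_finset {Fin.last n}ᶜ {Fin.last n} disjoint_compl_left hYm
    exact h.comp (φ := fun (z : (({Fin.last n}ᶜ : Finset (Fin (n + 1))) → ℝ)) (i : Fin n) =>
        z ⟨i.castSucc, by simp [(Fin.castSucc_lt_last i).ne]⟩)
      (ψ := fun z : (({Fin.last n} : Finset (Fin (n + 1))) → ℝ) => z ⟨Fin.last n, by simp⟩)
      (by fun_prop) (by fun_prop)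
  have hcond := condDistrib_ae_eq_map_of_indepFun hXm (hYm (Fin.last n)) hXY
  rw [hXπ, hlaw] at hcond
  -- A single `ε` here: one is lost on passing to `P(A)`, the other on passing from `P(C)` to the
  -- mixture mass of a competitor `C`.
  obtain ⟨A, hA, hQA, hAmin⟩ := hPk.exists_isUnionOfIntervals
    (b := 1 - α + γ + 2 * δ + ε) ⟨by linarith [hα.2, hγ.1], by linarith⟩
  have htv' : ∀ B, MeasurableSet B → |Pk.real B - P.real B| ≤ ε := fun B hB =>
    (abs_measureReal_sub_le_tvDistance Pk P hB).trans htv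
  have hPA : 1 - α + γ + 2 * δ ≤ P.real A := by
    have := (abs_le.1 (htv' A hA.measurableSet)).2
    linarith
  have hopt : volume A ≤ optVolume P (1 - α + γ + 2 * δ + 2 * ε) := by
    refine le_iInf fun C => le_iInf fun hC => le_iInf fun hPC => hAmin C hC ?_
    have h1 := (abs_le.1 (htv' C hC)).1
    have h2 := (ENNReal.ofReal_le_iff_le_toReal (measure_ne_top P C)).1 hPC
    rw [← measureReal_def] at h2
    linarith
  obtain ⟨G, hGm, hGle, hG⟩ := exists_uniform_deviation (k := k) hn hk P hδ0.le
    (by linarith) ((hexp _ (by linarith)).trans (by linarith [hδ.2]))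
  have hGle' : π G ≤ ENNReal.ofReal (δ / 2) := by
    refine hGle.trans (ENNReal.ofReal_le_ofReal ?_)
    have h1 := hexp ((n * δ / 4 - 3 / 2 * √(n * k)) ^ 2 / (2 * n)) (by
      rw [le_div_iff₀ (by linarith)]
      have h2 : n * δ / 8 ≤ n * δ / 4 - 3 / 2 * √(n * k) := by linarith
      have h3 := pow_le_pow_left₀ (by positivity) h2 2
      nlinarith)
    linarith
  -- A lower deviation on `A` is an upper deviation on its complement. `G` and `H` are each allotted
  -- probability `δ / 2`.
  set H := {y : Fin n → ℝ | n * (P.real Aᶜ + δ / 2) ≤ sampleCount y Aᶜ}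
  have hHle : π H ≤ ENNReal.ofReal (δ / 2) := by
    rw [← ofReal_measureReal]
    refine ENNReal.ofReal_le_ofReal ((measure_sampleCount_ge_le hn P hA.measurableSet.compl
      (by positivity)).trans ?_)
    have h1 := hexp (2 * n * (δ / 2) ^ 2) (by nlinarith)
    linarith
  -- The conditional law is `P` only almost surely, so the exceptional null set is discarded too;
  -- the measurable hull keeps the event measurable.
  set N := toMeasurable π (H ∪ {y | ¬ condDistrib (Y (Fin.last n)) X μ y = P})
  have hNle : π (G ∪ N) ≤ ENNReal.ofReal δ := by
    refine (measure_union_le _ _).trans ?_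
    rw [measure_toMeasurable, show δ = δ / 2 + δ / 2 by ring,
      ENNReal.ofReal_add (by positivity) (by positivity)]
    refine add_le_add hGle' ((measure_union_le _ _).trans ?_)
    rw [ae_iff.1 hcond, add_zero]
    exact hHle
  have hGN : MeasurableSet (G ∪ N) := hGm.union (measurableSet_toMeasurable _ _)
  refine ⟨X ⁻¹' (G ∪ N)ᶜ, hXm hGN.compl, ?_, ?_⟩
  · rw [← Measure.map_apply hXm hGN.compl, hXπ, prob_compl_eq_one_sub hGN,
      ENNReal.ofReal_sub _ hδ0.le, ENNReal.ofReal_one]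
    exact tsub_le_tsub_left hNle _
  · intro ω hω C hC
    rw [Set.mem_preimage, Set.mem_compl_iff, Set.mem_union, not_or] at hω
    have hωN := not_or.1 fun h => hω.2 (subset_toMeasurable _ _ h)
    have hωH : (sampleCount (X ω) Aᶜ : ℝ) < n * (P.real Aᶜ + δ / 2) := not_le.1 hωN.1
    have hωP : condDistrib (Y (Fin.last n)) X μ (X ω) = P := not_not.1 hωN.2
    rw [probReal_compl_eq_one_sub hA.measurableSet] at hωH
    have h1 := sampleCount_add_compl (X ω) A
    obtain ⟨hCu, hCP, hCv⟩ := hC.guarantee hn hk hα.2 hδ0 hγ.1 (by linarith) hA hPA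
      (by linarith) (hG (X ω) hω.1)
    refine ⟨hCu, ?_, hCv.trans hopt⟩
    rw [hωP]
    exact (ENNReal.ofReal_le_iff_le_toReal (measure_ne_top P C)).2 hCP
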